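/- Let $n\in\mathbb N$, let $\mathbb B_n$ be the open unit ball of $\mathbb C^n$, let $v$ be the normalized volume measure on $\mathbb B_n$, and let $L^2_a(\mathbb B_n)$ be the Bergman space of all holomorphic functions on $\mathbb B_n$ that are square integrable with respect to $v$, with norm $\|\cdot\|$ inherited from $L^2(v)$. Let $M\subset\mathbb B_n$ be any subset, let $P=\{f\in L^2_a(\mathbb B_n): f|_M=0\}$, and let $Q=P^{\perp}$ be its orthogonal complement in $L^2_a(\mathbb B_n)$. Suppose that $\mu$ is a positive finite Borel measure on $M$ for which there are constants $c,C>0$ such that $$c\|f\|^2\le\int_M|f(w)|^2\,d\mu(w)\le C\|f\|^2\qquad\text{for all } f\in Q.$$ Then: (1) $\mu$ is a Carleson measure for $L^2_a(\mathbb B_n)$, that is, there is $K<\infty$ such that $\int_M|f|^2\,d\mu\le K\int_{\mathbb B_n}|f|^2\,dv$ for all $f\in L^2_a(\mathbb B_n)$. (2) The formula $$T_\mu f(z)=\int_M\frac{f(w)}{(1-\langle z,w\rangle)^{n+1}}\,d\mu(w)\qquad(f\in L^2_a(\mathbb B_n),\ z\in\mathbb B_n),$$ with absolutely convergent integrals,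 defines a bounded self-adjoint operator $T_\mu$ on $L^2_a(\mathbb B_n)$, and there is a continuous function $g:\mathbb R\to\mathbb R$ such that $g(T_\mu)$, in the sense of the continuous functional calculus, is the orthogonal projection of $L^2_a(\mathbb B_n)$ onto $P$. (3) The submodule $P$ is essentially normal: if $A_i$ denotes the restriction to $P$ of the operator $M_{z_i}$ of multiplication by the coordinate $z_i$, then the commutators $A_iA_j^*-A_j^*A_i$ are compact for all $1\le i,j\le n$. (4) The quotient module $Q$ is essentially normal: if $B_i$ denotes the compression of $M_{z_i}$ to $Q$, then the commutators $B_iB_j^*-B_j^*B_i$ are compact for all $1\le i,j\le n$. -/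

import Mathlib

open MeasureTheory Metric Set Filter Topology
open scoped ENNReal NNReal

noncomputable section

/-- The normalized volume measure on the open unit ball of `ℂⁿ`, as a measure on `ℂⁿ`
concentrated on the ball. -/
def ballVolume (n : ℕ) : Measure (EuclideanSpace ℂ (Fin n)) :=
  (volume (ball (0 : EuclideanSpace ℂ (Fin n)) 1))⁻¹ •
    volume.restrict (ball (0 : EuclideanSpace ℂ (Fin n)) 1)

lemma volume_ball_ne_zero (n : ℕ) :
    volume (ball (0 : EuclideanSpace ℂ (Fin n)) 1) ≠ 0 :=
  (measure_ball_pos volume _ one_pos).ne'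

lemma volume_ball_ne_top (n : ℕ) :
    volume (ball (0 : EuclideanSpace ℂ (Fin n)) 1) ≠ ∞ := measure_ball_lt_top.ne

instance (n : ℕ) : IsProbabilityMeasure (ballVolume n) := ⟨by
  simp [ballVolume, ENNReal.inv_mul_cancel (volume_ball_ne_zero n) (volume_ball_ne_top n)]⟩

lemma ae_ballVolume_iff {n : ℕ} {p : EuclideanSpace ℂ (Fin n) → Prop} :
    (∀ᵐ z ∂(ballVolume n), p z) ↔
      ∀ᵐ z ∂(volume.restrict (ball (0 : EuclideanSpace ℂ (Fin n)) 1)), p z := by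
  rw [ballVolume, Measure.ae_ennreal_smul_measure_iff
    (ENNReal.inv_ne_zero.2 (volume_ball_ne_top n))]

lemma ae_mem_ball (n : ℕ) :
    ∀ᵐ z ∂(ballVolume n), z ∈ ball (0 : EuclideanSpace ℂ (Fin n)) 1 :=
  ae_ballVolume_iff.2 (ae_restrict_mem measurableSet_ball)

/-- The Bergman space of the unit ball, as the subspace of `L²(𝔹ₙ)` of (classes of)
holomorphic functions. -/
def bergmanSubmodule (n : ℕ) : Submodule ℂ (Lp ℂ 2 (ballVolume n)) where
  carrier := {f | ∃ g : EuclideanSpace ℂ (Fin n) → ℂ,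
    DifferentiableOn ℂ g (ball 0 1) ∧ f =ᵐ[ballVolume n] g}
  zero_mem' := ⟨0, differentiableOn_const 0, Lp.coeFn_zero _ _ _⟩
  add_mem' := by
    rintro a b ⟨g, hg, hag⟩ ⟨h, hh, hbh⟩
    exact ⟨g + h, hg.add hh, (Lp.coeFn_add a b).trans (hag.add hbh)⟩
  smul_mem' := by
    rintro c a ⟨g, hg, hag⟩
    exact ⟨c • g, hg.const_smul c, (Lp.coeFn_smul c a).trans (hag.const_smul c)⟩

/-- The Bergman space `L²ₐ(𝔹ₙ)`, with the inner product of `L²` of the normalized volume. -/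
def Bergman (n : ℕ) : Type := ↥(bergmanSubmodule n)

instance (n : ℕ) : NormedAddCommGroup (Bergman n) :=
  inferInstanceAs (NormedAddCommGroup ↥(bergmanSubmodule n))

instance (n : ℕ) : InnerProductSpace ℂ (Bergman n) :=
  inferInstanceAs (InnerProductSpace ℂ ↥(bergmanSubmodule n))

/-- The inclusion of the Bergman space into `L²(𝔹ₙ)`. -/
def Bergman.toL2 {n : ℕ} (f : Bergman n) : Lp ℂ 2 (ballVolume n) := Subtype.val f

lemma Bergman.exists_holo {n : ℕ} (f : Bergman n) :
    ∃ g : EuclideanSpace ℂ (Fin n) → ℂ,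
      DifferentiableOn ℂ g (ball 0 1) ∧ f.toL2 =ᵐ[ballVolume n] g := Subtype.property f

/-- The holomorphic function on the ball given by an element of the Bergman space
(extended by `0` outside of the ball). -/
def holo {n : ℕ} (f : Bergman n) : EuclideanSpace ℂ (Fin n) → ℂ :=
  (ball (0 : EuclideanSpace ℂ (Fin n)) 1).indicator f.exists_holo.choose

lemma holo_differentiableOn {n : ℕ} (f : Bergman n) :
    DifferentiableOn ℂ (holo f) (ball 0 1) :=
  f.exists_holo.choose_spec.1.congr fun _ hz => indicator_of_mem hz _

lemma holo_ae_eq {n : ℕ} (f : Bergman n) : f.toL2 =ᵐ[ballVolume n] holo f := by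
  filter_upwards [f.exists_holo.choose_spec.2, ae_mem_ball n] with z hz hzb
  rw [hz, holo, indicator_of_mem hzb]

lemma holo_of_notMem {n : ℕ} (f : Bergman n) {z : EuclideanSpace ℂ (Fin n)}
    (hz : z ∉ ball (0 : EuclideanSpace ℂ (Fin n)) 1) : holo f z = 0 := indicator_of_notMem hz _

/-- The holomorphic representative is unique. -/
lemma holo_eq_of_ae_eq {n : ℕ} (f : Bergman n) {g : EuclideanSpace ℂ (Fin n) → ℂ}
    (hg : ContinuousOn g (ball 0 1)) (hfg : f.toL2 =ᵐ[ballVolume n] g)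
    {z : EuclideanSpace ℂ (Fin n)} (hz : z ∈ ball (0 : EuclideanSpace ℂ (Fin n)) 1) :
    holo f z = g z := by
  have h : holo f =ᵐ[volume.restrict (ball (0 : EuclideanSpace ℂ (Fin n)) 1)] g :=
    ae_ballVolume_iff.1 ((holo_ae_eq f).symm.trans hfg)
  exact Measure.eqOn_open_of_ae_eq h isOpen_ball (holo_differentiableOn f).continuousOn hg hz

lemma holo_ext {n : ℕ} {f g : Bergman n}
    (h : ∀ z ∈ ball (0 : EuclideanSpace ℂ (Fin n)) 1, holo f z = holo g z) : f = g := by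
  have h0 : f.toL2 = g.toL2 := by
    refine Lp.ext ?_
    filter_upwards [holo_ae_eq f, holo_ae_eq g, ae_mem_ball n] with z h1 h2 hz
    rw [h1, h2, h z hz]
  exact Subtype.ext h0

lemma holo_add {n : ℕ} (f g : Bergman n) (z : EuclideanSpace ℂ (Fin n)) :
    holo (f + g) z = holo f z + holo g z := by
  by_cases hz : z ∈ ball (0 : EuclideanSpace ℂ (Fin n)) 1
  · exact holo_eq_of_ae_eq (f + g) (g := holo f + holo g)
      ((holo_differentiableOn f).continuousOn.add (holo_differentiableOn g).continuousOn)
      ((Lp.coeFn_add _ _).trans ((holo_ae_eq f).add (holo_ae_eq g))) hz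
  · simp [holo_of_notMem _ hz]

lemma holo_smul {n : ℕ} (c : ℂ) (f : Bergman n) (z : EuclideanSpace ℂ (Fin n)) :
    holo (c • f) z = c * holo f z := by
  by_cases hz : z ∈ ball (0 : EuclideanSpace ℂ (Fin n)) 1
  · exact holo_eq_of_ae_eq (c • f) (g := c • holo f)
      ((holo_differentiableOn f).continuousOn.const_smul c)
      ((Lp.coeFn_smul _ _).trans ((holo_ae_eq f).const_smul c)) hz
  · simp [holo_of_notMem _ hz]

lemma holo_zero {n : ℕ} (z : EuclideanSpace ℂ (Fin n)) : holo (0 : Bergman n) z = 0 := by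
  simpa using holo_smul 0 (0 : Bergman n) z

lemma holo_sub {n : ℕ} (f g : Bergman n) (z : EuclideanSpace ℂ (Fin n)) :
    holo (f - g) z = holo f z - holo g z := by
  rw [sub_eq_add_neg, holo_add, ← neg_one_smul ℂ g, holo_smul]; ring

lemma measurable_holo {n : ℕ} (f : Bergman n) : Measurable (holo f) := by
  have : holo f = (ball (0 : EuclideanSpace ℂ (Fin n)) 1).indicator (holo f) := by
    ext z
    by_cases hz : z ∈ ball (0 : EuclideanSpace ℂ (Fin n)) 1
    · rw [indicator_of_mem hz]
    · rw [indicator_of_notMem hz, holo_of_notMem f hz]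
  rw [this]
  refine measurable_of_restrict_of_restrict_compl
    (measurableSet_ball (x := (0 : EuclideanSpace ℂ (Fin n))) (ε := 1)) ?_ ?_
  · have : ((ball (0 : EuclideanSpace ℂ (Fin n)) 1).domRestrict
        ((ball (0 : EuclideanSpace ℂ (Fin n)) 1).indicator (holo f))) =
        (ball (0 : EuclideanSpace ℂ (Fin n)) 1).domRestrict (holo f) := by
      ext ⟨z, hz⟩
      exact indicator_of_mem hz _
    rw [this]
    exact (continuousOn_iff_continuous_domRestrict.1
      (holo_differentiableOn f).continuousOn).measurable
  · have : ((ball (0 : EuclideanSpace ℂ (Fin n)) 1)ᶜ.domRestrict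
        ((ball (0 : EuclideanSpace ℂ (Fin n)) 1).indicator (holo f))) = fun _ => 0 := by
      ext ⟨z, hz⟩
      exact indicator_of_notMem hz _
    rw [this]
    exact measurable_const

/-- Sub-mean value property over balls. -/
lemma enorm_mul_volume_le {n : ℕ} (f : Bergman n) {z : EuclideanSpace ℂ (Fin n)} {r : ℝ}
    (hz : closedBall z r ⊆ ball 0 1) :
    ‖holo f z‖ₑ * volume (ball (0 : EuclideanSpace ℂ (Fin n)) r) ≤
      ∫⁻ w in ball (0 : EuclideanSpace ℂ (Fin n)) 1, ‖holo f w‖ₑ := by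
  set I : Set ℝ := Ioc 0 (2 * Real.pi)
  have hI : volume I = ENNReal.ofReal (2 * Real.pi) := by simp [I]
  have hpi : (0 : ℝ) < 2 * Real.pi := by positivity
  have hm := measurable_holo f
  have key : ∀ w ∈ ball (0 : EuclideanSpace ℂ (Fin n)) r,
      ‖holo f z‖ₑ * volume I ≤ ∫⁻ θ in I, ‖holo f (z + circleMap 0 1 θ • w)‖ₑ := by
    intro w hw
    have hd : DifferentiableOn ℂ (fun ζ : ℂ => holo f (z + ζ • w)) (closedBall 0 1) := by
      refine (holo_differentiableOn f).comp (by fun_prop) ?_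
      intro ζ hζ
      apply hz
      rw [mem_closedBall, dist_eq_norm, add_sub_cancel_left, norm_smul]
      rw [mem_ball_zero_iff] at hw
      rw [mem_closedBall_zero_iff] at hζ
      nlinarith [norm_nonneg w, norm_nonneg ζ]
    have hc : DiffContOnCl ℂ (fun ζ : ℂ => holo f (z + ζ • w)) (ball 0 |1|) := by
      rw [abs_one]
      refine (DifferentiableOn.diffContOnCl ?_)
      rwa [closure_ball _ one_ne_zero]
    have h1 := hc.circleAverage
    rw [Real.circleAverage_def] at h1
    simp only [zero_smul, add_zero] at h1
    have h2 : (2 * Real.pi) • holo f z = ∫ θ in I, holo f (z + circleMap 0 1 θ • w) := by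
      rw [← h1, smul_smul, mul_inv_cancel₀ hpi.ne', one_smul,
        intervalIntegral.integral_of_le hpi.le]
    calc ‖holo f z‖ₑ * volume I = ‖(2 * Real.pi) • holo f z‖ₑ := by
          rw [enorm_smul, hI, mul_comm, Real.enorm_eq_ofReal hpi.le]
      _ ≤ _ := by rw [h2]; exact enorm_integral_le_lintegral_enorm _
  have hIpos : volume I ≠ 0 := by rw [hI]; simpa using hpi
  have hItop : volume I ≠ ∞ := by rw [hI]; exact ENNReal.ofReal_ne_top
  have hmeas : Measurable (fun p : EuclideanSpace ℂ (Fin n) × ℝ =>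
      ‖holo f (z + circleMap 0 1 p.2 • p.1)‖ₑ) := by
    have hcont : Continuous (fun p : EuclideanSpace ℂ (Fin n) × ℝ =>
      z + circleMap 0 1 p.2 • p.1) := by
      have := continuous_circleMap 0 1
      fun_prop
    exact (hm.comp hcont.measurable).enorm
  have rot : ∀ θ : ℝ, ∫⁻ w in ball (0 : EuclideanSpace ℂ (Fin n)) r,
      ‖holo f (z + circleMap 0 1 θ • w)‖ₑ ≤
      ∫⁻ w in ball (0 : EuclideanSpace ℂ (Fin n)) 1, ‖holo f w‖ₑ := by
    intro θ
    have hnorm : ‖circleMap 0 1 θ‖ = 1 := by simp [norm_circleMap_zero]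
    let e : EuclideanSpace ℂ (Fin n) ≃ₗᵢ[ℝ] EuclideanSpace ℂ (Fin n) :=
      { (LinearEquiv.smulOfNeZero ℂ (EuclideanSpace ℂ (Fin n)) (circleMap 0 1 θ)
          (by rw [← norm_pos_iff, hnorm]; exact one_pos)).restrictScalars ℝ with
        norm_map' := fun w => by
          change ‖circleMap 0 1 θ • w‖ = ‖w‖
          rw [norm_smul, hnorm, one_mul] }
    have he : MeasurePreserving (fun w => z + circleMap 0 1 θ • w)
        (volume : Measure (EuclideanSpace ℂ (Fin n))) volume :=
      (measurePreserving_add_left volume z).comp e.measurePreserving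
    have hsub : ball (0 : EuclideanSpace ℂ (Fin n)) r ⊆
        (fun w => z + circleMap 0 1 θ • w) ⁻¹' (ball 0 1) := by
      intro w hw
      apply hz
      rw [mem_closedBall, dist_eq_norm, add_sub_cancel_left, norm_smul, hnorm, one_mul]
      exact (mem_ball_zero_iff.1 hw).le
    calc _ ≤ ∫⁻ w in (fun w => z + circleMap 0 1 θ • w) ⁻¹' (ball 0 1),
            ‖holo f (z + circleMap 0 1 θ • w)‖ₑ := lintegral_mono_set hsub
      _ = _ := he.setLIntegral_comp_preimage measurableSet_ball hm.enorm
  have step : volume I * (‖holo f z‖ₑ * volume (ball (0 : EuclideanSpace ℂ (Fin n)) r)) ≤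
      volume I * ∫⁻ w in ball (0 : EuclideanSpace ℂ (Fin n)) 1, ‖holo f w‖ₑ := by
    calc _ = ∫⁻ w in ball (0 : EuclideanSpace ℂ (Fin n)) r, ‖holo f z‖ₑ * volume I := by
          rw [setLIntegral_const]; ring
      _ ≤ ∫⁻ w in ball (0 : EuclideanSpace ℂ (Fin n)) r,
            ∫⁻ θ in I, ‖holo f (z + circleMap 0 1 θ • w)‖ₑ :=
          setLIntegral_mono' measurableSet_ball key
      _ = ∫⁻ θ in I, ∫⁻ w in ball (0 : EuclideanSpace ℂ (Fin n)) r,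
            ‖holo f (z + circleMap 0 1 θ • w)‖ₑ :=
          lintegral_lintegral_swap hmeas.aemeasurable
      _ ≤ ∫⁻ θ in I, ∫⁻ w in ball (0 : EuclideanSpace ℂ (Fin n)) 1, ‖holo f w‖ₑ :=
          lintegral_mono fun θ => rot θ
      _ = _ := by rw [setLIntegral_const, mul_comm]
  exact (ENNReal.mul_le_mul_iff_right hIpos hItop).1 step

/-- Point evaluations are bounded, locally uniformly on the ball. -/
lemma norm_holo_le {n : ℕ} {r : ℝ} (hr : 0 < r) :
    ∃ K : ℝ, 0 ≤ K ∧ ∀ (f : Bergman n) (z : EuclideanSpace ℂ (Fin n)),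
      closedBall z r ⊆ ball 0 1 → ‖holo f z‖ ≤ K * ‖f‖ := by
  set V := volume (ball (0 : EuclideanSpace ℂ (Fin n)) 1)
  set W := volume (ball (0 : EuclideanSpace ℂ (Fin n)) r)
  have hW0 : W ≠ 0 := (measure_ball_pos volume _ hr).ne'
  have hWt : W ≠ ∞ := measure_ball_lt_top.ne
  have hV0 : V ≠ 0 := volume_ball_ne_zero n
  have hVt : V ≠ ∞ := volume_ball_ne_top n
  refine ⟨(V / W).toReal, ENNReal.toReal_nonneg, fun f z hz => ?_⟩
  have h1 := enorm_mul_volume_le f hz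
  have h2 : ∫⁻ w in ball (0 : EuclideanSpace ℂ (Fin n)) 1, ‖holo f w‖ₑ =
      V * ∫⁻ w, ‖holo f w‖ₑ ∂(ballVolume n) := by
    rw [ballVolume, lintegral_smul_measure, smul_eq_mul, ← mul_assoc,
      ENNReal.mul_inv_cancel hV0 hVt, one_mul]
  have h3 : ∫⁻ w, ‖holo f w‖ₑ ∂(ballVolume n) ≤ ‖f‖ₑ := by
    rw [← eLpNorm_one_eq_lintegral_enorm]
    calc eLpNorm (holo f) 1 (ballVolume n) ≤ eLpNorm (holo f) 2 (ballVolume n) :=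
          eLpNorm_le_eLpNorm_of_exponent_le (by norm_num)
            (measurable_holo f).aestronglyMeasurable
      _ = eLpNorm f.toL2 2 (ballVolume n) :=
          (eLpNorm_congr_ae (holo_ae_eq f)).symm
      _ = ‖f.toL2‖ₑ := (Lp.enorm_def _).symm
      _ = ‖f‖ₑ := rfl
  have h4 : ‖holo f z‖ₑ ≤ V / W * ‖f‖ₑ := by
    rw [ENNReal.mul_comm_div, mul_div_assoc' , ENNReal.le_div_iff_mul_le (Or.inl hW0) (Or.inl hWt)]
    exact h1.trans (h2.trans_le (by gcongr))
  have h5 := ENNReal.toReal_mono (ENNReal.mul_ne_top (ENNReal.div_ne_top hVt hW0) (by simp)) h4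
  simpa [ENNReal.toReal_mul] using h5

lemma closedBall_subset_of_mem {n : ℕ} {R r : ℝ} (hR : R + r < 1) {z : EuclideanSpace ℂ (Fin n)}
    (hz : z ∈ ball (0 : EuclideanSpace ℂ (Fin n)) R) : closedBall z r ⊆ ball 0 1 := by
  intro w hw
  have h1 := mem_closedBall.1 hw
  have h2 := mem_ball.1 hz
  have h3 := dist_triangle w z 0
  exact mem_ball.2 (by linarith)

lemma norm_fderiv_holo_le {n : ℕ} {R : ℝ} (hR : R < 1) :
    ∃ K : ℝ, 0 ≤ K ∧ ∀ (f : Bergman n), ∀ z ∈ ball (0 : EuclideanSpace ℂ (Fin n)) R,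
      ‖fderiv ℂ (holo f) z‖ ≤ K * ‖f‖ := by
  set r := (1 - R) / 3
  have hr : 0 < r := by simp only [r]; linarith
  obtain ⟨K, hK, h⟩ := norm_holo_le (n := n) hr
  refine ⟨2 * K / r, by positivity, fun f z hz => ?_⟩
  have hsub : ball z r ⊆ ball 0 (R + r) := by
    intro w hw
    have h1 := mem_ball.1 hw
    have h2 := mem_ball.1 hz
    have h3 := dist_triangle w z 0
    exact mem_ball.2 (by linarith)
  have hb : ∀ w ∈ ball z r, ‖holo f w‖ ≤ K * ‖f‖ := fun w hw =>
    h f w (closedBall_subset_of_mem (by simp only [r]; linarith) (hsub hw))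
  have hd : DifferentiableOn ℂ (holo f) (ball z r) :=
    (holo_differentiableOn f).mono
      (hsub.trans (ball_subset_ball (by simp only [r]; linarith)))
  have := Complex.norm_fderiv_le_div_of_mapsTo_ball (R₂ := 2 * K * ‖f‖) hd (fun w hw => by
    rw [mem_closedBall, dist_eq_norm]
    have h1 := hb w hw
    have h2 := hb z (mem_ball_self hr)
    have h3 := norm_sub_le (holo f w) (holo f z)
    linarith) hr
  calc _ ≤ _ := this
    _ = _ := by ring

lemma isClosed_bergman (n : ℕ) : IsClosed (bergmanSubmodule n : Set (Lp ℂ 2 (ballVolume n))) := by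
  refine IsSeqClosed.isClosed ?_
  intro u v hu huv
  let U : ℕ → Bergman n := fun k => ⟨u k, hu k⟩
  have hUc : CauchySeq U := by
    have h1 : CauchySeq u := huv.cauchySeq
    rw [Metric.cauchySeq_iff] at h1 ⊢
    exact h1
  have hsub : ∀ {ε : ℝ}, 0 < ε → ∃ N, ∀ k ≥ N, ∀ m ≥ N, ‖U k - U m‖ < ε := by
    intro ε hε
    obtain ⟨N, hN⟩ := Metric.cauchySeq_iff.1 hUc ε hε
    exact ⟨N, fun k hk m hm => by rw [← dist_eq_norm]; exact hN k hk m hm⟩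
  have hdiffAt : ∀ (f : Bergman n), ∀ z ∈ ball (0 : EuclideanSpace ℂ (Fin n)) 1,
      DifferentiableAt ℂ (holo f) z := fun f z hz =>
    (holo_differentiableOn f z hz).differentiableAt (isOpen_ball.mem_nhds hz)
  have hmem : ∀ z ∈ ball (0 : EuclideanSpace ℂ (Fin n)) 1, ∃ R < 1, z ∈ ball 0 R := by
    intro z hz
    obtain ⟨R, h1, h2⟩ := exists_between (mem_ball.1 hz)
    exact ⟨R, h2, mem_ball.2 h1⟩
  -- pointwise limits
  have hlim : ∀ z ∈ ball (0 : EuclideanSpace ℂ (Fin n)) 1,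
      ∃ a, Tendsto (fun k => holo (U k) z) atTop (𝓝 a) := by
    intro z hz
    obtain ⟨R, hR, hzR⟩ := hmem z hz
    obtain ⟨K, hK, h⟩ := norm_holo_le (n := n) (r := (1 - R) / 2) (by linarith)
    refine cauchySeq_tendsto_of_complete (Metric.cauchySeq_iff.2 fun ε hε => ?_)
    obtain ⟨N, hN⟩ := hsub (ε := ε / (K + 1)) (by positivity)
    refine ⟨N, fun k hk m hm => ?_⟩
    rw [dist_eq_norm, ← holo_sub]
    have h1 := h (U k - U m) z (closedBall_subset_of_mem (by linarith) hzR)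
    have h2 := (lt_div_iff₀ (by positivity)).1 (hN k hk m hm)
    nlinarith [norm_nonneg (U k - U m)]
  choose! g hg using hlim
  have hgd : DifferentiableOn ℂ g (ball 0 1) := by
    intro z hz
    obtain ⟨R, hR, hzR⟩ := hmem z hz
    obtain ⟨K, hK, h⟩ := norm_fderiv_holo_le (n := n) hR
    have hcau : UniformCauchySeqOn (fun k => fderiv ℂ (holo (U k))) atTop
        (ball (0 : EuclideanSpace ℂ (Fin n)) R) := by
      rw [Metric.uniformCauchySeqOn_iff]
      intro ε hε
      obtain ⟨N, hN⟩ := hsub (ε := ε / (K + 1)) (by positivity)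
      refine ⟨N, fun k hk m hm x hx => ?_⟩
      have hx1 : x ∈ ball (0 : EuclideanSpace ℂ (Fin n)) 1 := ball_subset_ball hR.le hx
      have h1 := h (U k - U m) x hx
      have h0 : holo (U k - U m) = holo (U k) - holo (U m) := funext fun y => holo_sub _ _ y
      rw [h0, fderiv_sub (hdiffAt _ x hx1) (hdiffAt _ x hx1)] at h1
      have h2 := (lt_div_iff₀ (by positivity)).1 (hN k hk m hm)
      rw [dist_eq_norm]
      nlinarith [norm_nonneg (U k - U m)]
    have hl : ∀ x ∈ ball (0 : EuclideanSpace ℂ (Fin n)) R,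
        ∃ a, Tendsto (fun k => fderiv ℂ (holo (U k)) x) atTop (𝓝 a) := fun x hx =>
      cauchySeq_tendsto_of_complete (hcau.cauchySeq hx)
    choose! g' hg' using hl
    have hunif := hcau.tendstoUniformlyOn_of_tendsto hg'
    exact (hasFDerivAt_of_tendstoUniformlyOn isOpen_ball hunif
      (fun k x hx => (hdiffAt (U k) x (ball_subset_ball hR.le hx)).hasFDerivAt)
      (fun x hx => hg x (ball_subset_ball hR.le hx)) hzR).differentiableAt.differentiableWithinAt
  refine ⟨g, hgd, ?_⟩
  obtain ⟨ns, hns, hae⟩ := (tendstoInMeasure_of_tendsto_Lp huv).exists_seq_tendsto_ae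
  have hall : ∀ᵐ z ∂(ballVolume n), ∀ k, u k z = holo (U k) z :=
    ae_all_iff.2 fun k => holo_ae_eq (U k)
  filter_upwards [hae, hall, ae_mem_ball n] with z h1 h2 hz
  refine tendsto_nhds_unique h1 ?_
  simp only [h2]
  exact (hg z hz).comp hns.tendsto_atTop

instance (n : ℕ) : CompleteSpace (Bergman n) :=
  haveI : CompleteSpace ↥(bergmanSubmodule n) := (isClosed_bergman n).completeSpace_coe
  inferInstanceAs (CompleteSpace ↥(bergmanSubmodule n))

lemma memLp_holo {n : ℕ} (f : Bergman n) : MemLp (holo f) 2 (ballVolume n) :=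
  (memLp_congr_ae (holo_ae_eq f)).1 (Lp.memLp _)

/-- The element of the Bergman space given by a square integrable holomorphic function. -/
def Bergman.mk {n : ℕ} (g : EuclideanSpace ℂ (Fin n) → ℂ) (hg : DifferentiableOn ℂ g (ball 0 1))
    (hg2 : MemLp g 2 (ballVolume n)) : Bergman n :=
  ⟨hg2.toLp g, g, hg, hg2.coeFn_toLp⟩

lemma holo_mk {n : ℕ} {g : EuclideanSpace ℂ (Fin n) → ℂ} (hg : DifferentiableOn ℂ g (ball 0 1))
    (hg2 : MemLp g 2 (ballVolume n)) {z : EuclideanSpace ℂ (Fin n)}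
    (hz : z ∈ ball (0 : EuclideanSpace ℂ (Fin n)) 1) : holo (Bergman.mk g hg hg2) z = g z :=
  holo_eq_of_ae_eq (Bergman.mk g hg hg2) hg.continuousOn hg2.coeFn_toLp hz

lemma ae_norm_coord_mul_le {n : ℕ} (i : Fin n) (f : Bergman n) :
    ∀ᵐ z ∂(ballVolume n), ‖z i * holo f z‖ ≤ ‖holo f z‖ := by
  filter_upwards [ae_mem_ball n] with z hz
  rw [norm_mul]
  have h1 := PiLp.norm_apply_le z i
  have h2 := mem_ball_zero_iff.1 hz
  nlinarith [norm_nonneg (holo f z)]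

lemma memLp_coord_mul {n : ℕ} (i : Fin n) (f : Bergman n) :
    MemLp (fun z => z i * holo f z) 2 (ballVolume n) :=
  (memLp_holo f).mono
    ((by fun_prop : Measurable fun z : EuclideanSpace ℂ (Fin n) => z i).mul
      (measurable_holo f)).aestronglyMeasurable (ae_norm_coord_mul_le i f)

lemma differentiableOn_coord_mul {n : ℕ} (i : Fin n) (f : Bergman n) :
    DifferentiableOn ℂ (fun z => z i * holo f z) (ball 0 1) :=
  (by fun_prop : DifferentiableOn ℂ (fun z : EuclideanSpace ℂ (Fin n) => z i) (ball 0 1)).mul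
    (holo_differentiableOn f)

/-- The coordinate multiplication operator `M_{z_i}`, `(M_{z_i} f)(z) = z_i f(z)`, on the
Bergman space. -/
def coordMul {n : ℕ} (i : Fin n) : Bergman n →L[ℂ] Bergman n :=
  LinearMap.mkContinuous
    { toFun := fun f => Bergman.mk (fun z => z i * holo f z) (differentiableOn_coord_mul i f)
        (memLp_coord_mul i f)
      map_add' := fun f g => holo_ext fun z hz => by
        simp only [holo_add, holo_mk _ _ hz]; ring
      map_smul' := fun c f => holo_ext fun z hz => by
        simp only [holo_smul, holo_mk _ _ hz, RingHom.id_apply]; ring }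
    1 (fun f => by
      rw [one_mul]
      change ‖(memLp_coord_mul i f).toLp _‖ ≤ ‖f.toL2‖
      refine Lp.norm_le_norm_of_ae_le ?_
      filter_upwards [(memLp_coord_mul i f).coeFn_toLp, holo_ae_eq f,
        ae_norm_coord_mul_le i f] with z h1 h2 h3
      rwa [h1, h2])

lemma holo_coordMul {n : ℕ} (i : Fin n) (f : Bergman n) (z : EuclideanSpace ℂ (Fin n)) :
    holo (coordMul i f) z = z i * holo f z := by
  by_cases hz : z ∈ ball (0 : EuclideanSpace ℂ (Fin n)) 1
  · exact holo_mk (differentiableOn_coord_mul i f) (memLp_coord_mul i f) hz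
  · simp [holo_of_notMem _ hz]

/-- The submodule `P` of all functions in the Bergman space that vanish on `M`. -/
def vanishingSubmodule {n : ℕ} (M : Set (EuclideanSpace ℂ (Fin n))) :
    Submodule ℂ (Bergman n) where
  carrier := {f | ∀ z ∈ M, holo f z = 0}
  zero_mem' := fun z _ => holo_zero z
  add_mem' := fun ha hb z hz => by rw [holo_add, ha z hz, hb z hz, add_zero]
  smul_mem' := fun c f hf z hz => by rw [holo_smul, hf z hz, mul_zero]

lemma continuous_holo_apply {n : ℕ} (z : EuclideanSpace ℂ (Fin n)) :
    Continuous fun f : Bergman n => holo f z := by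
  by_cases hz : z ∈ ball (0 : EuclideanSpace ℂ (Fin n)) 1
  · obtain ⟨R, h1, h2⟩ := exists_between (mem_ball.1 hz)
    obtain ⟨K, hK, h⟩ := norm_holo_le (n := n) (r := (1 - R) / 2) (by linarith)
    let L : Bergman n →ₗ[ℂ] ℂ :=
      { toFun := fun f => holo f z
        map_add' := fun f g => holo_add f g z
        map_smul' := fun c f => holo_smul c f z }
    refine (L.mkContinuous K fun f => ?_).continuous
    exact h f z (closedBall_subset_of_mem (by linarith) (mem_ball.2 h1))
  · simp only [holo_of_notMem _ hz]
    exact continuous_const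

lemma isClosed_vanishingSubmodule {n : ℕ} (M : Set (EuclideanSpace ℂ (Fin n))) :
    IsClosed (vanishingSubmodule M : Set (Bergman n)) := by
  have : (vanishingSubmodule M : Set (Bergman n)) = ⋂ z ∈ M, {f | holo f z = 0} := by
    ext f; simp [vanishingSubmodule]
  rw [this]
  exact isClosed_biInter fun z _ => isClosed_eq (continuous_holo_apply z) continuous_const

instance {n : ℕ} (M : Set (EuclideanSpace ℂ (Fin n))) : CompleteSpace (vanishingSubmodule M) :=
  (isClosed_vanishingSubmodule M).completeSpace_coe

lemma coordMul_mem {n : ℕ} (M : Set (EuclideanSpace ℂ (Fin n))) (i : Fin n) (f : Bergman n)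
    (hf : f ∈ vanishingSubmodule M) : coordMul i f ∈ vanishingSubmodule M := fun z hz => by
  rw [holo_coordMul, hf z hz, mul_zero]

/-- The module multiplication by `z_i` on the submodule `P`: the restriction of `M_{z_i}`. -/
def submoduleMul {n : ℕ} (M : Set (EuclideanSpace ℂ (Fin n))) (i : Fin n) :
    vanishingSubmodule M →L[ℂ] vanishingSubmodule M :=
  ((coordMul i).comp (vanishingSubmodule M).subtypeL).codRestrict (vanishingSubmodule M)
    fun f => coordMul_mem M i f f.2

/-- The module multiplication by `z_i` on the quotient module `Q = P^⊥`: the compression of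
`M_{z_i}` to `Q`. -/
def quotientMul {n : ℕ} (M : Set (EuclideanSpace ℂ (Fin n))) (i : Fin n) :
    (vanishingSubmodule M)ᗮ →L[ℂ] (vanishingSubmodule M)ᗮ :=
  (vanishingSubmodule M)ᗮ.orthogonalProjectionOnto.comp
    ((coordMul i).comp (vanishingSubmodule M)ᗮ.subtypeL)

/-- A Hilbert module over `ℂ[z₁, …, zₙ]`, given by the operators `A i` of multiplication by the
coordinates, is essentially normal if all commutators `[A i, (A j)*]` are compact. -/
def IsEssentiallyNormal {n : ℕ} {H : Type*} [NormedAddCommGroup H] [InnerProductSpace ℂ H]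
    [CompleteSpace H] (A : Fin n → H →L[ℂ] H) : Prop :=
  ∀ i j, IsCompactOperator
    (A i * ContinuousLinearMap.adjoint (A j) - ContinuousLinearMap.adjoint (A j) * A i)

/-- A measure on `ℂⁿ` (concentrated on the ball) is a Carleson measure for the Bergman space if
`∫ |f|² dν ≤ K ∫ |f|² dv` for all `f` in the Bergman space, for some constant `K`. -/
def IsCarlesonMeasure {n : ℕ} (ν : Measure (EuclideanSpace ℂ (Fin n))) : Prop :=
  ∃ K : ℝ≥0, ∀ f : Bergman n,
    ∫⁻ w, ‖holo f w‖ₑ ^ 2 ∂ν ≤ K * ∫⁻ w, ‖holo f w‖ₑ ^ 2 ∂(ballVolume n)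

/-- `T` is the bounded operator `T_ν` on the Bergman space:
`(T_ν f)(z) = ∫ f(w) / (1 - ⟨z, w⟩)ⁿ⁺¹ dν(w)`, the integral being absolutely convergent, for all
`f` and all `z` in the ball. The inner product `⟨z, w⟩ = ∑ zᵢ conj(wᵢ)` is `inner ℂ w z`. -/
def IsToeplitzOperator {n : ℕ} (ν : Measure (EuclideanSpace ℂ (Fin n)))
    (T : Bergman n →L[ℂ] Bergman n) : Prop :=
  ∀ f : Bergman n, ∀ z ∈ ball (0 : EuclideanSpace ℂ (Fin n)) 1,
    Integrable (fun w => holo f w / (1 - inner ℂ w z) ^ (n + 1)) ν ∧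
    holo (T f) z = ∫ w, holo f w / (1 - inner ℂ w z) ^ (n + 1) ∂ν

end

/-! Let `ν` be the push-forward of `μ` to `ℂⁿ`, `J` the embedding of the Bergman space into `L²(ν)`,
and write `P`, `Q` also for the two projections. Since elements of `P` vanish on `M`, the integral
of `|f|²` sees only the `Q`-part of `f`, so the upper estimate on `Q` is already the Carleson
condition. Hence `T = J* J` is bounded, and pairing with reproducing kernels identifies it with
`T_μ`.

`T` vanishes on `P` and is bounded below by `c` on `Q`, so its spectrum lies in `{0} ∪ [c, ∞)`
(`zero_or_le_of_mem_spectrum`). A continuous function equal to `1` at `0` and to `0` on `[c, ∞)`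
turns `T` into the projection onto `P`, and the projection onto `Q` factors as `S T` with `S`
bounded (`exists_cfc_eq_starProjection`).

Essential normality rests on the compactness, for every finite Carleson measure on the ball, of the
defect `D_i f = conj w_i · f - M_{z_i}^* f` as an operator into `L²(ν)`
(`isCompactOperator_defectOp`). By the reproducing property, `D_i` is an integral operator whose
kernel is `w_i - z_i` times the Bergman kernel. Because `‖z - w‖² ≤ 2 |1 - ⟨z, w⟩|`, this factor
gains half an order over the singularity, and Schur's test makes the contribution of the region near
the sphere small. Away from the sphere Montel's theorem applies.

Now `M_{z_i}^* T - T M_{z_i}^* = J* D_i`. For `ν = v` one has `T = 1`, and `D_j` yields the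
compactness of `[M_{z_i}, M_{z_j}^*]`. For the given measure, `Q M_{z_i}^* P = S T M_{z_i}^* P = -S
J* D_i P` is compact (`isCompactOperator_corner`). The commutators on `P` and on `Q` are algebraic
combinations of these two kinds of operators.

The reproducing formula itself comes from the Gaussian: translation and the mean value property give
it on the Fock space, rotation isolates each degree, radial integration passes to the ball, and the
binomial series sums the degrees. -/

open scoped BoundedContinuousFunction

noncomputable section

/-! ### Circle-invariant measures and averaging over rotations -/

/-- The space `ℂⁿ` with its Euclidean norm. -/
abbrev CSpace (n : ℕ) : Type := EuclideanSpace ℂ (Fin n)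

/-- A measure on `ℂⁿ` is circular if it is invariant under multiplication by unimodular
scalars. -/
def IsCircular {n : ℕ} (ν : Measure (CSpace n)) : Prop :=
  ∀ c : ℂ, ‖c‖ = 1 → MeasurePreserving (fun w : CSpace n => c • w) ν ν

/-- Multiplication by a unimodular scalar as a real linear isometry. -/
def unimodularSMul {n : ℕ} (c : ℂ) (hc : ‖c‖ = 1) : CSpace n ≃ₗᵢ[ℝ] CSpace n :=
  { (LinearEquiv.smulOfNeZero ℂ (CSpace n) c
      (by rw [← norm_pos_iff, hc]; exact one_pos)).restrictScalars ℝ with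
    norm_map' := fun w => by
      change ‖c • w‖ = ‖w‖
      rw [norm_smul, hc, one_mul] }

lemma isCircular_volume (n : ℕ) : IsCircular (volume : Measure (CSpace n)) :=
  fun c hc => (unimodularSMul c hc).measurePreserving

lemma smul_mem_ball_iff {n : ℕ} {c : ℂ} (hc : ‖c‖ = 1) (w : CSpace n) :
    c • w ∈ ball (0 : CSpace n) 1 ↔ w ∈ ball (0 : CSpace n) 1 := by
  simp [norm_smul, hc]

lemma isCircular_ballVolume (n : ℕ) : IsCircular (ballVolume n) := by
  intro c hc
  have h := (isCircular_volume n c hc).restrict_preimage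
    (measurableSet_ball (x := (0 : CSpace n)) (ε := 1))
  have h2 : (fun w : CSpace n => c • w) ⁻¹' ball (0 : CSpace n) 1 = ball 0 1 := by
    ext w; exact smul_mem_ball_iff hc w
  rw [h2] at h
  exact h.smul_measure _

/-- Averaging over the circle action does not change the integral. -/
lemma integral_eq_integral_circleAverage {n : ℕ} {ν : Measure (CSpace n)} [SFinite ν]
    (hν : IsCircular ν) {h : CSpace n → ℂ} (hi : Integrable h ν) :
    ∫ w, h w ∂ν = ∫ w, Real.circleAverage (fun ζ => h (ζ • w)) 0 1 ∂ν := by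
  have hpi : (0 : ℝ) < 2 * Real.pi := by positivity
  let I := Ioc (0 : ℝ) (2 * Real.pi)
  have hcm : Measurable (Function.uncurry fun (θ : ℝ) (w : CSpace n) => circleMap 0 1 θ • w) := by
    have := continuous_circleMap 0 1
    exact Continuous.measurable (by unfold Function.uncurry; fun_prop)
  -- The map `(θ, w) ↦ (θ, e^{iθ} w)` preserves the product measure. This supplies the joint
  -- integrability that the exchange of integrals needs.
  have hsk := (MeasurePreserving.id (volume.restrict I)).skew_product (μc := ν) (μd := ν) hcm
    (ae_of_all _ fun θ => (hν (circleMap 0 1 θ) (by simp [norm_circleMap_zero])).map_eq)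
  have hint : Integrable (fun p : ℝ × CSpace n => h (circleMap 0 1 p.1 • p.2))
      ((volume.restrict I).prod ν) := by
    have h1 : Integrable (fun p : ℝ × CSpace n => h p.2) ((volume.restrict I).prod ν) := by
      simpa using Integrable.mul_prod (f := fun _ : ℝ => (1 : ℂ)) (integrable_const 1) hi
    exact hsk.integrable_comp_of_integrable h1
  have hrot : ∀ θ : ℝ, ∫ w, h (circleMap 0 1 θ • w) ∂ν = ∫ w, h w ∂ν := by
    intro θ
    have hmp := hν (circleMap 0 1 θ) (by simp [norm_circleMap_zero])
    have := integral_map hmp.measurable.aemeasurable (f := h)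
      (by rw [hmp.map_eq]; exact hi.aestronglyMeasurable)
    rw [hmp.map_eq] at this
    exact this.symm
  calc ∫ w, h w ∂ν = (2 * Real.pi)⁻¹ • ∫ θ in I, ∫ w, h (circleMap 0 1 θ • w) ∂ν := by
        simp only [hrot, integral_const, smul_smul]
        have : (volume.restrict I).real univ = 2 * Real.pi := by
          simp [I, Measure.real, Real.pi_pos.le]
        rw [this, inv_mul_cancel₀ hpi.ne', one_smul]
    _ = (2 * Real.pi)⁻¹ • ∫ w, (∫ θ in I, h (circleMap 0 1 θ • w)) ∂ν := by
        rw [integral_integral_swap]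
        exact hint
    _ = _ := by
        rw [← integral_smul]
        refine integral_congr_ae (ae_of_all _ fun w => ?_)
        simp only [Real.circleAverage_def, intervalIntegral.integral_of_le hpi.le, I]

/-! ### Gaussian integrals and the Fock space -/

/-- Half of the Gaussian exponent absorbs the growth, since `a t ≤ a² / 2 + t² / 2`. -/
lemma integrable_mul_exp_neg_norm_sq {n : ℕ} {h : CSpace n → ℂ} (hc : Continuous h) {C a : ℝ}
    (hb : ∀ w, ‖h w‖ ≤ C * Real.exp (a * ‖w‖)) :
    Integrable (fun w => h w * (Real.exp (-‖w‖ ^ 2) : ℂ)) := by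
  have h1 : Integrable (fun w : CSpace n => Real.exp (-(1 / 2 : ℝ) * ‖w‖ ^ 2)) := by
    have := (GaussianFourier.integrable_cexp_neg_mul_sq_norm_add (b := (1 / 2 : ℝ))
      (V := CSpace n) (by norm_num) 0 0).norm
    refine this.congr (ae_of_all _ fun w => ?_)
    simp only [zero_mul, add_zero, Complex.norm_exp]
    norm_cast
  refine (h1.const_mul (C * Real.exp (a ^ 2 / 2))).mono'
    (Continuous.aestronglyMeasurable (by fun_prop)) (ae_of_all _ fun w => ?_)
  have hC : 0 ≤ C := by
    have := (norm_nonneg _).trans (hb 0)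
    simpa using this
  rw [norm_mul, Complex.norm_real, Real.norm_eq_abs, abs_of_pos (Real.exp_pos _)]
  calc _ ≤ C * Real.exp (a * ‖w‖) * Real.exp (-‖w‖ ^ 2) := by gcongr; exact hb w
    _ = C * Real.exp (a * ‖w‖ + -‖w‖ ^ 2) := by rw [mul_assoc, ← Real.exp_add]
    _ ≤ C * Real.exp (a ^ 2 / 2 + -(1 / 2 : ℝ) * ‖w‖ ^ 2) := by
        refine mul_le_mul_of_nonneg_left (Real.exp_le_exp.2 ?_) hC
        nlinarith [sq_nonneg (a - ‖w‖)]
    _ = _ := by rw [mul_assoc, ← Real.exp_add]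

/-- The total mass of the Gaussian `exp (-‖w‖²)` on `ℂⁿ`. -/
def gaussMass (n : ℕ) : ℂ := ∫ w : CSpace n, (Real.exp (-‖w‖ ^ 2) : ℂ)

lemma norm_smul_of_mem_sphere {n : ℕ} {ζ : ℂ} (hζ : ζ ∈ sphere (0 : ℂ) |1|) (w : CSpace n) :
    ‖ζ • w‖ = ‖w‖ := by
  rw [mem_sphere_zero_iff_norm, abs_one] at hζ
  rw [norm_smul, hζ, one_mul]

/-- Mean value property for the Gaussian measure. -/
lemma integral_entire_mul_exp_neg_norm_sq {n : ℕ} {h : CSpace n → ℂ} (hd : Differentiable ℂ h)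
    {C a : ℝ} (hb : ∀ w, ‖h w‖ ≤ C * Real.exp (a * ‖w‖)) :
    ∫ w, h w * (Real.exp (-‖w‖ ^ 2) : ℂ) = h 0 * gaussMass n := by
  rw [integral_eq_integral_circleAverage (isCircular_volume n)
    (integrable_mul_exp_neg_norm_sq hd.continuous hb), gaussMass, ← integral_const_mul]
  refine integral_congr_ae (ae_of_all _ fun w => ?_)
  -- On the circle the weight does not depend on `ζ`. Freezing it leaves a function holomorphic in
  -- `ζ`, whose average is its value at `0`.
  have h1 : EqOn (fun ζ : ℂ => h (ζ • w) * (Real.exp (-‖ζ • w‖ ^ 2) : ℂ))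
      (fun ζ : ℂ => (h (ζ • w) * (Real.exp (-‖w‖ ^ 2) : ℂ))) (sphere 0 |1|) := by
    intro ζ hζ
    simp only [norm_smul_of_mem_sphere hζ]
  have h2 : DiffContOnCl ℂ (fun ζ : ℂ => (h (ζ • w) * (Real.exp (-‖w‖ ^ 2) : ℂ)))
      (ball 0 |1|) := by
    apply Differentiable.diffContOnCl
    fun_prop
  simp only []
  rw [Real.circleAverage_congr_sphere h1, h2.circleAverage]
  simp

/-- The reproducing formula of the Fock space. -/
lemma integral_fock {n : ℕ} {F : CSpace n → ℂ} (hF : Differentiable ℂ F) {C a : ℝ} (ha : 0 ≤ a)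
    (hb : ∀ w, ‖F w‖ ≤ C * Real.exp (a * ‖w‖)) (z : CSpace n) :
    ∫ w, F w * Complex.exp (inner ℂ w z) * (Real.exp (-‖w‖ ^ 2) : ℂ) = F z * gaussMass n := by
  have hC : 0 ≤ C := by
    have := (norm_nonneg _).trans (hb 0)
    simpa using this
  -- After the shift by `z` the exponent `⟨w, z⟩ - ‖w‖²` becomes `-⟨z, w⟩ - ‖w‖²` (Mathlib's
  -- `inner`). The antiholomorphic factor has turned into a holomorphic one, so the mean value
  -- property at `w = 0` applies.
  rw [← integral_add_right_eq_self _ z]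
  have h1 : ∀ w : CSpace n, F (w + z) * Complex.exp (inner ℂ (w + z) z) *
      (Real.exp (-‖w + z‖ ^ 2) : ℂ) =
      F (w + z) * Complex.exp (-inner ℂ z w) * (Real.exp (-‖w‖ ^ 2) : ℂ) := by
    intro w
    have h2 : ((‖w + z‖ ^ 2 : ℝ) : ℂ) = ((‖w‖ ^ 2 : ℝ) : ℂ) + inner ℂ w z + inner ℂ z w
        + ((‖z‖ ^ 2 : ℝ) : ℂ) := by
      have := inner_self_eq_norm_sq_to_K (𝕜 := ℂ) (w + z)
      have e1 := inner_self_eq_norm_sq_to_K (𝕜 := ℂ) w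
      have e2 := inner_self_eq_norm_sq_to_K (𝕜 := ℂ) z
      rw [inner_add_left, inner_add_right, inner_add_right] at this
      simp only [Complex.coe_algebraMap] at this e1 e2
      push_cast
      rw [← this, ← e1, ← e2]; ring
    have h3 : (inner ℂ z z : ℂ) = ((‖z‖ ^ 2 : ℝ) : ℂ) := by
      rw [inner_self_eq_norm_sq_to_K]; simp
    rw [mul_assoc, mul_assoc, Complex.ofReal_exp, Complex.ofReal_exp, ← Complex.exp_add,
      ← Complex.exp_add, inner_add_left, h3, Complex.ofReal_neg, h2, Complex.ofReal_neg]
    congr 2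
    ring
  simp only [h1]
  have hin : Differentiable ℂ (fun w : CSpace n => (inner ℂ z w : ℂ)) :=
    (innerSL ℂ z).differentiable
  rw [integral_entire_mul_exp_neg_norm_sq
    (h := fun w => F (w + z) * Complex.exp (-inner ℂ z w)) (C := C * Real.exp (a * ‖z‖))
    (a := a + ‖z‖) (by fun_prop) ?_]
  · simp
  · intro w
    rw [norm_mul, Complex.norm_exp]
    calc _ ≤ (C * Real.exp (a * ‖w + z‖)) * Real.exp (‖z‖ * ‖w‖) := by
          gcongr
          · exact hb _
          · calc _ ≤ ‖-(inner ℂ z w : ℂ)‖ := Complex.re_le_norm _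
              _ ≤ _ := by rw [norm_neg]; exact norm_inner_le_norm _ _
      _ ≤ (C * Real.exp (a * (‖w‖ + ‖z‖))) * Real.exp (‖z‖ * ‖w‖) := by
          gcongr
          exact norm_add_le _ _
      _ = _ := by
          rw [mul_assoc, mul_assoc, ← Real.exp_add, ← Real.exp_add]; ring_nf

/-- `F` is homogeneous of degree `m`. -/
def IsHomogeneousFun {n : ℕ} (F : CSpace n → ℂ) (m : ℕ) : Prop :=
  ∀ (c : ℂ) (w : CSpace n), F (c • w) = c ^ m * F w

lemma IsHomogeneousFun.exists_norm_le {n m : ℕ} {F : CSpace n → ℂ} (hF : IsHomogeneousFun F m)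
    (hc : Continuous F) : ∃ C, 0 ≤ C ∧ ∀ w, ‖F w‖ ≤ C * ‖w‖ ^ m := by
  obtain ⟨C, hC⟩ := (isCompact_closedBall (0 : CSpace n) 1).exists_bound_of_continuousOn
    hc.continuousOn
  have hC0 : 0 ≤ C := (norm_nonneg _).trans (hC 0 (by simp))
  refine ⟨C, hC0, fun w => ?_⟩
  have key : ∃ u : CSpace n, ‖u‖ ≤ 1 ∧ w = (‖w‖ : ℂ) • u := by
    by_cases hw : w = 0
    · exact ⟨0, by simp, by simp [hw]⟩
    · have : (‖w‖ : ℂ) ≠ 0 := by simpa using hw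
      refine ⟨(‖w‖ : ℂ)⁻¹ • w, ?_, by rw [smul_smul, mul_inv_cancel₀ this, one_smul]⟩
      rw [norm_smul, norm_inv, Complex.norm_real, norm_norm]
      exact (inv_mul_cancel₀ (by simpa using hw)).le
  obtain ⟨u, hu, hwu⟩ := key
  calc ‖F w‖ = ‖F ((‖w‖ : ℂ) • u)‖ := by rw [← hwu]
    _ = ‖w‖ ^ m * ‖F u‖ := by rw [hF, norm_mul, norm_pow, Complex.norm_real, norm_norm]
    _ ≤ ‖w‖ ^ m * C := by gcongr; exact hC u (by simpa using hu)
    _ = _ := mul_comm _ _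

lemma IsHomogeneousFun.exists_norm_le_exp {n m : ℕ} {F : CSpace n → ℂ}
    (hF : IsHomogeneousFun F m) (hc : Continuous F) : ∃ C, ∀ w, ‖F w‖ ≤ C * Real.exp (1 * ‖w‖) := by
  obtain ⟨C, hC0, hC⟩ := hF.exists_norm_le hc
  refine ⟨C * m.factorial, fun w => (hC w).trans ?_⟩
  have := Real.pow_div_factorial_le_exp ‖w‖ (norm_nonneg w) m
  rw [div_le_iff₀ (by positivity)] at this
  rw [one_mul, mul_assoc, mul_comm (m.factorial : ℝ)]
  gcongr

lemma continuous_inner_left {n : ℕ} (z : CSpace n) :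
    Continuous (fun w : CSpace n => (inner ℂ w z : ℂ)) := by fun_prop

/-- Rotation by such a `c` reverses the sign of a function that is homogeneous of degree `m` in `w`
and of degree `k` in `conj w`; its integral against a rotation-invariant weight therefore vanishes.
The witness is `exp (iπ / (m - k))`. -/
lemma exists_unimodular_pow_eq_neg_one {m k : ℕ} (h : k ≠ m) :
    ∃ c : ℂ, ‖c‖ = 1 ∧ c ^ m * (starRingEnd ℂ c) ^ k = -1 := by
  have hj : ((m : ℂ) - k) ≠ 0 := by
    rw [sub_ne_zero]; exact_mod_cast h.symm
  have hr : ((Real.pi / ((m : ℝ) - k) : ℝ) : ℂ) = Real.pi / ((m : ℂ) - k) := by push_cast; rfl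
  refine ⟨Complex.exp ((Real.pi / ((m : ℝ) - k) : ℝ) * Complex.I), Complex.norm_exp_ofReal_mul_I _,
    ?_⟩
  rw [← Complex.exp_conj, ← Complex.exp_nat_mul, ← Complex.exp_nat_mul, ← Complex.exp_add,
    map_mul, Complex.conj_ofReal, Complex.conj_I, hr, ← Complex.exp_pi_mul_I]
  congr 1
  field_simp
  ring

/-- The reproducing formula of the Fock space for homogeneous functions. -/
lemma integral_homogeneous_mul_exp_neg_norm_sq {n m : ℕ} {F : CSpace n → ℂ}
    (hF : IsHomogeneousFun F m) (hd : Differentiable ℂ F) (z : CSpace n) :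
    ∫ w, F w * inner ℂ w z ^ m * (Real.exp (-‖w‖ ^ 2) : ℂ) =
      m.factorial * (F z * gaussMass n) := by
  obtain ⟨C, hC⟩ := hF.exists_norm_le_exp hd.continuous
  have hC0 : 0 ≤ C := by
    have := (norm_nonneg _).trans (hC 0)
    simpa using this
  have hFc := hd.continuous
  have hin := continuous_inner_left z
  -- The terms of the exponential series in the Fock formula; by rotation invariance only degree `k
  -- = m` has a nonzero integral.
  set G : ℕ → CSpace n → ℂ := fun k w =>
    F w * ((inner ℂ w z) ^ k / k.factorial) * (Real.exp (-‖w‖ ^ 2) : ℂ) with hG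
  have hsum : HasSum (fun k => ∫ w, G k w)
      (∫ w, F w * Complex.exp (inner ℂ w z) * (Real.exp (-‖w‖ ^ 2) : ℂ)) := by
    have hs : ∀ w : CSpace n, HasSum (fun k : ℕ => ‖F w‖ * ((‖w‖ * ‖z‖) ^ k / k.factorial) *
        Real.exp (-‖w‖ ^ 2)) (‖F w‖ * Real.exp (‖w‖ * ‖z‖) * Real.exp (-‖w‖ ^ 2)) := by
      intro w
      have := NormedSpace.expSeries_div_hasSum_exp (𝔸 := ℝ) (‖w‖ * ‖z‖)
      rw [← Real.exp_eq_exp_ℝ] at this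
      exact (this.mul_left _).mul_right _
    refine hasSum_integral_of_dominated_convergence
      (fun k w => ‖F w‖ * ((‖w‖ * ‖z‖) ^ k / k.factorial) * Real.exp (-‖w‖ ^ 2)) ?_ ?_ ?_ ?_ ?_
    · exact fun k => Continuous.aestronglyMeasurable (by simp only [hG]; fun_prop)
    · refine fun k => ae_of_all _ fun w => ?_
      simp only [hG, norm_mul, norm_div, norm_pow, Complex.norm_natCast, Complex.norm_real,
        Real.norm_eq_abs, abs_of_pos (Real.exp_pos _)]
      gcongr
      exact norm_inner_le_norm w z
    · exact ae_of_all _ fun w => (hs w).summable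
    · simp only [(hs _).tsum_eq]
      have := (integrable_mul_exp_neg_norm_sq (n := n)
        (h := fun w => F w * (Real.exp (‖w‖ * ‖z‖) : ℂ)) (by fun_prop) (C := C)
        (a := 1 + ‖z‖) ?_).norm
      · refine this.congr (ae_of_all _ fun w => ?_)
        simp only [norm_mul, Complex.norm_real, Real.norm_eq_abs, abs_of_pos (Real.exp_pos _)]
      · intro w
        rw [norm_mul, Complex.norm_real, Real.norm_eq_abs, abs_of_pos (Real.exp_pos _), add_mul,
          Real.exp_add, ← mul_assoc, mul_comm ‖z‖]
        gcongr
        exact hC w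
    · refine ae_of_all _ fun w => ?_
      have := NormedSpace.expSeries_div_hasSum_exp (𝔸 := ℂ) (inner ℂ w z)
      rw [← Complex.exp_eq_exp_ℂ] at this
      exact (this.mul_left _).mul_right _
  have hzero : ∀ k, k ≠ m → ∫ w, G k w = 0 := by
    intro k hk
    obtain ⟨c, hc, hcm⟩ := exists_unimodular_pow_eq_neg_one hk
    have hrot : ∀ w, G k (c • w) = -G k w := by
      intro w
      simp only [hG, hF c w, inner_smul_left, mul_pow, norm_smul, hc, one_mul]
      linear_combination (F w * ((inner ℂ w z) ^ k / k.factorial) *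
        (Real.exp (-‖w‖ ^ 2) : ℂ)) * hcm
    have h1 : ∫ w, G k (c • w) = ∫ w, G k w :=
      (unimodularSMul c hc).measurePreserving.integral_comp
        (unimodularSMul c hc).toHomeomorph.measurableEmbedding (G k)
    simp only [hrot, integral_neg] at h1
    exact CharZero.neg_eq_self_iff.1 h1
  have h2 := (hasSum_single m hzero).unique hsum
  rw [integral_fock hd zero_le_one hC z] at h2
  rw [← h2, ← integral_const_mul]
  refine integral_congr_ae (ae_of_all _ fun w => ?_)
  have : (m.factorial : ℂ) ≠ 0 := by exact_mod_cast m.factorial_ne_zero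
  simp only [hG]
  field_simp

/-! ### From the Gaussian to the ball -/

lemma integral_exp_neg_mul_pow (k : ℕ) :
    ∫ s in Ioi (0 : ℝ), Real.exp (-s) * s ^ k = k.factorial := by
  rw [← Real.Gamma_nat_eq_factorial, Real.Gamma_eq_integral (by positivity)]
  refine setIntegral_congr_fun measurableSet_Ioi fun s _ => ?_
  simp

lemma finrank_real_cspace (n : ℕ) : Module.finrank ℝ (CSpace n) = 2 * n := by
  rw [← Module.finrank_mul_finrank ℝ ℂ]; simp

open scoped Pointwise in
-- Scaling by `√s`: the Jacobian contributes `s ^ n`, the real dimension being `2n`, and homogeneity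
-- of degree `2m` contributes `s ^ m`.
lemma setIntegral_norm_sq_lt {n m : ℕ} {H : CSpace n → ℂ}
    (hH : ∀ r : ℝ, 0 < r → ∀ w, H (r • w) = (r : ℂ) ^ (2 * m) * H w) {s : ℝ} (hs : 0 < s) :
    ∫ w in {w : CSpace n | ‖w‖ ^ 2 < s}, H w = (s : ℂ) ^ (n + m) * ∫ w in ball 0 1, H w := by
  have hr := Real.sqrt_pos.2 hs
  have h1 := Measure.setIntegral_comp_smul_of_pos volume H (ball (0 : CSpace n) 1) hr
  have h2 : Real.sqrt s • ball (0 : CSpace n) 1 = {w : CSpace n | ‖w‖ ^ 2 < s} := by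
    rw [_root_.smul_ball hr.ne']
    ext w
    simp [abs_of_pos hr, Real.lt_sqrt]
  rw [h2, finrank_real_cspace] at h1
  simp only [hH _ hr, integral_const_mul] at h1
  have h3 : ∀ k : ℕ, ((Real.sqrt s : ℝ) : ℂ) ^ (2 * k) = (s : ℂ) ^ k := by
    intro k
    rw [pow_mul]; norm_cast; rw [Real.sq_sqrt hs.le]
  rw [h3, pow_mul, Real.sq_sqrt hs.le, Complex.real_smul, eq_comm, Complex.ofReal_inv,
    inv_mul_eq_iff_eq_mul₀ (by simp [hs.ne'])] at h1
  rw [h1, pow_add, Complex.ofReal_pow]; ring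

/-- Integration of homogeneous functions against the Gaussian, in terms of the ball. -/
lemma integral_homogeneous_exp_neg_norm_sq {n m : ℕ} {H : CSpace n → ℂ} (hc : Continuous H)
    (hH : ∀ r : ℝ, 0 < r → ∀ w, H (r • w) = (r : ℂ) ^ (2 * m) * H w)
    (hi : Integrable (fun w => H w * (Real.exp (-‖w‖ ^ 2) : ℂ))) :
    ∫ w, H w * (Real.exp (-‖w‖ ^ 2) : ℂ) = (n + m).factorial * ∫ w in ball 0 1, H w := by
  -- Layer cake: `exp (-‖w‖²)` is the integral of `exp (-s)` over `s > ‖w‖²`. After the exchange the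
  -- inner integral runs over a ball of radius `√s`, and the remaining Gamma integral is `(n + m)!`.
  set Φ : CSpace n → ℝ → ℂ := fun w s =>
    (Ioi (‖w‖ ^ 2)).indicator (fun s => H w * (Real.exp (-s) : ℂ)) s with hΦ
  have hE : ∀ w : CSpace n, ∫ s in Ioi (0 : ℝ), (Ioi (‖w‖ ^ 2)).indicator
      (fun s => Real.exp (-s)) s = Real.exp (-‖w‖ ^ 2) := by
    intro w
    rw [setIntegral_indicator measurableSet_Ioi, Ioi_inter_Ioi, sup_eq_right.2 (by positivity),
      integral_exp_neg_Ioi]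
  have hexp : ∀ w : CSpace n, Integrable ((Ioi (‖w‖ ^ 2)).indicator (fun s => Real.exp (-s)))
      (volume.restrict (Ioi 0)) := fun w =>
    (IntegrableOn.integrable (by simpa using exp_neg_integrableOn_Ioi 0 one_pos)).indicator
      measurableSet_Ioi
  have hΦ' : ∀ w s, Φ w s = H w * (((Ioi (‖w‖ ^ 2)).indicator (fun s => Real.exp (-s)) s : ℝ) : ℂ) := by
    intro w s
    by_cases h : s ∈ Ioi (‖w‖ ^ 2)
    · simp only [hΦ, indicator_of_mem h]
    · simp only [hΦ, indicator_of_notMem h]; simp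
  have hmeas : Measurable (Function.uncurry Φ) := by
    have : Function.uncurry Φ = {p : CSpace n × ℝ | ‖p.1‖ ^ 2 < p.2}.indicator
        (fun p => H p.1 * (Real.exp (-p.2) : ℂ)) := by
      ext ⟨w, s⟩
      by_cases h : s ∈ Ioi (‖w‖ ^ 2)
      · simp only [hΦ, Function.uncurry, indicator_of_mem h]
        rw [indicator_of_mem]; exact h
      · simp only [hΦ, Function.uncurry, indicator_of_notMem h]
        rw [indicator_of_notMem]; exact h
    rw [this]
    exact (Continuous.measurable (by fun_prop)).indicator
      (measurableSet_lt (by fun_prop) (by fun_prop))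
  have hint : Integrable (Function.uncurry Φ) (volume.prod (volume.restrict (Ioi 0))) := by
    rw [integrable_prod_iff hmeas.aestronglyMeasurable]
    refine ⟨ae_of_all _ fun w => ?_, ?_⟩
    · simp only [Function.uncurry, hΦ']
      exact ((hexp w).ofReal).const_mul _
    · refine hi.norm.congr (ae_of_all _ fun w => ?_)
      simp only [Function.uncurry, hΦ', norm_mul, Complex.norm_real, integral_const_mul]
      rw [Real.norm_eq_abs, abs_of_pos (Real.exp_pos _), ← hE w]
      congr 2
      ext s
      rw [Real.norm_eq_abs, abs_of_nonneg]
      exact indicator_nonneg (fun _ _ => (Real.exp_pos _).le) _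
  calc _ = ∫ w, ∫ s in Ioi (0 : ℝ), Φ w s := by
        refine integral_congr_ae (ae_of_all _ fun w => ?_)
        simp only [hΦ', integral_const_mul, integral_complex_ofReal, hE]
    _ = ∫ s in Ioi (0 : ℝ), ∫ w, Φ w s := integral_integral_swap hint
    _ = ∫ s in Ioi (0 : ℝ), ((Real.exp (-s) * s ^ (n + m) : ℝ) : ℂ) * ∫ w in ball 0 1, H w := by
        refine setIntegral_congr_fun measurableSet_Ioi fun s hs => ?_
        have : ∀ w, Φ w s = {w : CSpace n | ‖w‖ ^ 2 < s}.indicator H w * (Real.exp (-s) : ℂ) := by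
          intro w
          by_cases h : ‖w‖ ^ 2 < s
          · simp only [hΦ]
            rw [indicator_of_mem (show s ∈ Ioi (‖w‖ ^ 2) from h), indicator_of_mem]; exact h
          · simp only [hΦ]
            rw [indicator_of_notMem (show s ∉ Ioi (‖w‖ ^ 2) from h), indicator_of_notMem, zero_mul]
            exact h
        simp only [this, integral_mul_const]
        rw [integral_indicator (measurableSet_lt (by fun_prop) (by fun_prop)),
          setIntegral_norm_sq_lt hH hs]
        push_cast; ring
    _ = _ := by
        rw [integral_mul_const, integral_complex_ofReal, integral_exp_neg_mul_pow]
        norm_cast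

lemma gaussMass_eq (n : ℕ) :
    gaussMass n = n.factorial * (volume.real (ball (0 : CSpace n) 1) : ℂ) := by
  have := integral_homogeneous_exp_neg_norm_sq (n := n) (m := 0) (H := fun _ => 1)
    continuous_const (fun r _ w => by simp)
    (integrable_mul_exp_neg_norm_sq continuous_const (C := 1) (a := 0) (by simp))
  simp only [one_mul] at this
  rw [gaussMass, this]
  simp

lemma volume_real_ball_ne_zero (n : ℕ) : volume.real (ball (0 : CSpace n) 1) ≠ 0 := by
  rw [Measure.real, ENNReal.toReal_ne_zero]
  exact ⟨volume_ball_ne_zero n, volume_ball_ne_top n⟩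

lemma integral_ballVolume {n : ℕ} (f : CSpace n → ℂ) :
    ∫ w, f w ∂(ballVolume n) =
      (volume.real (ball (0 : CSpace n) 1) : ℂ)⁻¹ * ∫ w in ball 0 1, f w := by
  rw [ballVolume, integral_smul_measure, ENNReal.toReal_inv, Complex.real_smul,
    Complex.ofReal_inv]
  rfl

/-- The reproducing formula of the Bergman space for homogeneous functions. -/
lemma integral_homogeneous_mul_inner_pow {n m : ℕ} {F : CSpace n → ℂ}
    (hF : IsHomogeneousFun F m) (hd : Differentiable ℂ F) (z : CSpace n) :
    ((m + n).choose n : ℂ) * ∫ w, F w * inner ℂ w z ^ m ∂(ballVolume n) = F z := by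
  have hFc := hd.continuous
  have hin := continuous_inner_left z
  have hG : IsHomogeneousFun (fun w : CSpace n => inner ℂ z w ^ m) m := fun c w => by
    simp only [inner_smul_right, mul_pow]
  obtain ⟨C, hC0, hC⟩ := hF.exists_norm_le hd.continuous
  obtain ⟨C', hC'⟩ := hF.exists_norm_le_exp hd.continuous
  obtain ⟨D, hD⟩ := hG.exists_norm_le_exp (by fun_prop)
  have h1 := integral_homogeneous_exp_neg_norm_sq (n := n) (m := m)
    (H := fun w => F w * inner ℂ w z ^ m) (by fun_prop) (fun r _ w => by
      have := hF (r : ℂ) w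
      rw [Complex.coe_smul] at this
      rw [this, ← Complex.coe_smul, inner_smul_left, Complex.conj_ofReal]
      ring)
    (integrable_mul_exp_neg_norm_sq (by fun_prop) (C := C' * D) (a := 2) (fun w => by
      rw [norm_mul, norm_pow, norm_inner_symm, ← norm_pow]
      calc _ ≤ (C' * Real.exp (1 * ‖w‖)) * (D * Real.exp (1 * ‖w‖)) :=
            mul_le_mul (hC' w) (hD w) (norm_nonneg _) ((norm_nonneg _).trans (hC' w))
        _ = C' * D * (Real.exp (1 * ‖w‖ + 1 * ‖w‖)) := by rw [Real.exp_add]; ring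
        _ = _ := by ring_nf))
  rw [integral_homogeneous_mul_exp_neg_norm_sq hF hd z, gaussMass_eq] at h1
  have hV : (volume.real (ball (0 : CSpace n) 1) : ℂ) ≠ 0 :=
    Complex.ofReal_ne_zero.2 (volume_real_ball_ne_zero n)
  -- The Gaussian integral equals `m! n! vol(𝔹ₙ) F(z)` by the Fock formula and `(n + m)!` times the
  -- integral over the ball by radial integration. The quotient of the factorials is this binomial
  -- coefficient.
  have hch : ((m + n).choose n : ℂ) * (m.factorial * n.factorial) = (n + m).factorial := by
    have := Nat.add_choose_mul_factorial_mul_factorial m n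
    rw [add_comm n m, ← this]
    have e := Nat.choose_symm_add (a := m) (b := n)
    rw [← e]
    push_cast; ring
  have hm : (m.factorial : ℂ) ≠ 0 := by exact_mod_cast m.factorial_ne_zero
  have hn : (n.factorial : ℂ) ≠ 0 := by exact_mod_cast n.factorial_ne_zero
  rw [integral_ballVolume]
  rw [← hch] at h1
  have h2 : ((m.factorial : ℂ) * n.factorial) *
      (F z * (volume.real (ball (0 : CSpace n) 1) : ℂ)) = ((m.factorial : ℂ) * n.factorial) *
      (((m + n).choose n : ℂ) * ∫ w in ball 0 1, F w * inner ℂ w z ^ m) := by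
    linear_combination h1
  have h3 := mul_left_cancel₀ (mul_ne_zero hm hn) h2
  rw [mul_left_comm, ← h3]
  field_simp

/-! ### Homogeneous expansion and the Bergman reproducing formula -/

/-- The homogeneous part of degree `m` of `f` at the origin. -/
def homogeneousPart {n : ℕ} (m : ℕ) (f : CSpace n → ℂ) (w : CSpace n) : ℂ :=
  iteratedDeriv m (fun ζ : ℂ => f (ζ • w)) 0 / m.factorial

lemma iteratedDeriv_comp_mul_left (m : ℕ) (φ : ℂ → ℂ) (c : ℂ) :
    iteratedDeriv m (fun ζ => φ (c * ζ)) = fun ζ => c ^ m * iteratedDeriv m φ (c * ζ) := by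
  induction m with
  | zero => simp
  | succ m ih =>
    ext ζ
    rw [iteratedDeriv_succ, ih, deriv_const_mul_field, deriv_comp_mul_left, iteratedDeriv_succ,
      smul_eq_mul]
    ring

lemma isHomogeneousFun_homogeneousPart {n : ℕ} (m : ℕ) (f : CSpace n → ℂ) :
    IsHomogeneousFun (homogeneousPart m f) m := by
  intro c w
  have := congrFun (iteratedDeriv_comp_mul_left m (fun ζ : ℂ => f (ζ • w)) c) 0
  simp only [homogeneousPart, smul_smul, mul_comm _ c]
  rw [this, mul_zero, mul_div_assoc]

lemma smul_mem_ball_of_lt {n : ℕ} {R : ℝ} {w : CSpace n} (hRw : R * ‖w‖ < 1) {ζ : ℂ}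
    (hζ : ‖ζ‖ ≤ R) : ζ • w ∈ ball (0 : CSpace n) 1 := by
  rw [mem_ball_zero_iff, norm_smul]
  exact (mul_le_mul_of_nonneg_right hζ (norm_nonneg _)).trans_lt hRw

lemma differentiableOn_slice {n : ℕ} {f : CSpace n → ℂ} (hf : DifferentiableOn ℂ f (ball 0 1))
    {R : ℝ} {w : CSpace n} (hRw : R * ‖w‖ < 1) :
    DifferentiableOn ℂ (fun ζ : ℂ => f (ζ • w)) (closedBall 0 R) :=
  hf.comp (by fun_prop) fun _ hζ => smul_mem_ball_of_lt hRw (by simpa using hζ)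

/-- Cauchy's formula on the slice through `w`. The radius is free: `R = 1` serves for `w` in the
ball, while a small `R` reaches any `w` in `ℂⁿ`. -/
lemma homogeneousPart_eq_circleAverage {n : ℕ} (m : ℕ) {f : CSpace n → ℂ}
    (hf : DifferentiableOn ℂ f (ball 0 1)) {R : ℝ} (hR : 0 < R) {w : CSpace n}
    (hRw : R * ‖w‖ < 1) :
    homogeneousPart m f w = Real.circleAverage (fun ζ => (ζ ^ m)⁻¹ * f (ζ • w)) 0 R := by
  have h1 : DiffContOnCl ℂ (fun ζ : ℂ => f (ζ • w)) (ball 0 R) := by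
    refine DifferentiableOn.diffContOnCl ?_
    rw [closure_ball _ hR.ne']
    exact differentiableOn_slice hf hRw
  have h2 := h1.circleIntegral_one_div_sub_center_pow_smul hR m
  have hm : (m.factorial : ℂ) ≠ 0 := by exact_mod_cast m.factorial_ne_zero
  have hpi : (2 * Real.pi * Complex.I : ℂ) ≠ 0 := Complex.two_pi_I_ne_zero
  rw [Real.circleAverage_eq_circleIntegral hR.ne', homogeneousPart]
  have h3 : (∮ z in C((0 : ℂ), R), (z - 0)⁻¹ • ((z ^ m)⁻¹ * f (z • w))) =
      ∮ z in C((0 : ℂ), R), (1 / (z - 0) ^ (m + 1)) • f (z • w) := by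
    congr 1
    ext z
    simp only [sub_zero, smul_eq_mul, pow_succ, one_div, mul_inv]
    ring
  rw [h3, h2, smul_eq_mul, smul_eq_mul]
  field_simp

/-- The Taylor series at `0` of the slice `ζ ↦ f (ζ z)`, evaluated at `ζ = 1`, which is interior
because the slice is holomorphic on a disc of radius `R > 1`. -/
lemma hasSum_homogeneousPart {n : ℕ} {f : CSpace n → ℂ} (hf : DifferentiableOn ℂ f (ball 0 1))
    {z : CSpace n} (hz : z ∈ ball (0 : CSpace n) 1) :
    HasSum (fun m => homogeneousPart m f z) (f z) := by
  have hz1 : ‖z‖ < 1 := by simpa using hz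
  obtain ⟨R, hR, hRz⟩ : ∃ R : ℝ, 1 < R ∧ R * ‖z‖ < 1 := by
    refine ⟨2 / (1 + ‖z‖), ?_, ?_⟩
    · rw [lt_div_iff₀ (by positivity)]; linarith
    · rw [div_mul_eq_mul_div, div_lt_one (by positivity)]; linarith
  have := Complex.hasSum_taylorSeries_on_ball (f := fun ζ : ℂ => f (ζ • z)) (c := 0) (r := R)
    (z := 1) ((differentiableOn_slice hf hRz).mono ball_subset_closedBall) (by simpa using hR)
  simp only [sub_zero, one_pow, one_smul, smul_eq_mul, one_mul] at this
  refine this.congr_fun fun m => ?_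
  rw [homogeneousPart, div_eq_inv_mul]

/-- Differentiation under the integral sign in Cauchy's formula. -/
lemma differentiable_homogeneousPart {n : ℕ} (m : ℕ) (g : Bergman n) :
    Differentiable ℂ (homogeneousPart m (holo g)) := by
  intro w₀
  have hpi : (0 : ℝ) < 2 * Real.pi := by positivity
  -- With this radius the points `R e^{iθ} w`, for `‖w - w₀‖ < 1`, stay in the ball of radius `1 /
  -- 2`, where the derivative of `holo g` is uniformly bounded.
  set R : ℝ := (2 * (‖w₀‖ + 1))⁻¹ with hRdef
  have hR : 0 < R := by positivity
  have hRw : ∀ w ∈ ball w₀ 1, R * ‖w‖ < 1 / 2 := by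
    intro w hw
    have h1 : ‖w‖ < ‖w₀‖ + 1 := by
      have := mem_ball_iff_norm.1 hw
      have := norm_sub_norm_le w w₀
      linarith
    rw [hRdef, inv_mul_lt_iff₀ (by positivity)]
    linarith
  obtain ⟨K, hK, hfd⟩ := norm_fderiv_holo_le (n := n) (R := 1 / 2) (by norm_num)
  have hf := holo_differentiableOn g
  have heq : homogeneousPart m (holo g) =ᶠ[𝓝 w₀] fun w => (2 * Real.pi)⁻¹ •
      ∫ θ in Ioc (0 : ℝ) (2 * Real.pi),
        (circleMap 0 R θ ^ m)⁻¹ * holo g (circleMap 0 R θ • w) := by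
    filter_upwards [ball_mem_nhds w₀ one_pos] with w hw
    rw [homogeneousPart_eq_circleAverage m hf hR ((hRw w hw).trans (by norm_num)),
      Real.circleAverage_def, intervalIntegral.integral_of_le hpi.le]
  refine (DifferentiableAt.congr_of_eventuallyEq ?_ heq)
  suffices hsuff : DifferentiableAt ℂ (fun w => ∫ θ in Ioc (0 : ℝ) (2 * Real.pi),
      (circleMap 0 R θ ^ m)⁻¹ * holo g (circleMap 0 R θ • w)) w₀ from
    hsuff.const_smul ((2 * Real.pi)⁻¹ : ℝ)
  have hcm := continuous_circleMap 0 R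
  have hnorm : ∀ θ, ‖circleMap 0 R θ‖ = R := fun θ => by
    rw [norm_circleMap_zero, abs_of_pos hR]
  have hne : ∀ θ, circleMap 0 R θ ≠ 0 := fun θ => by
    rw [← norm_pos_iff, hnorm]; exact hR
  have hmem : ∀ θ, ∀ w ∈ ball w₀ 1, circleMap 0 R θ • w ∈ ball (0 : CSpace n) (1 / 2) := by
    intro θ w hw
    rw [mem_ball_zero_iff, norm_smul, hnorm]
    exact hRw w hw
  have hsub : ball (0 : CSpace n) (1 / 2) ⊆ ball 0 1 := ball_subset_ball (by norm_num)
  have hcont : ∀ w ∈ ball w₀ 1, Continuous fun θ =>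
      (circleMap 0 R θ ^ m)⁻¹ * holo g (circleMap 0 R θ • w) := by
    intro w hw
    refine Continuous.mul ((hcm.pow m).inv₀ fun θ => pow_ne_zero _ (hne θ)) ?_
    exact hf.continuousOn.comp_continuous (by fun_prop) fun θ => hsub (hmem θ w hw)
  have hmeasF' : Measurable fun θ => ((circleMap 0 R θ ^ m)⁻¹ * circleMap 0 R θ) •
      fderiv ℂ (holo g) (circleMap 0 R θ • w₀) := by
    have h1 : Measurable fun θ => (circleMap 0 R θ ^ m)⁻¹ * circleMap 0 R θ :=
      (((hcm.pow m).inv₀ fun θ => pow_ne_zero _ (hne θ)).mul hcm).measurable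
    have h2 : Measurable fun θ => fderiv ℂ (holo g) (circleMap 0 R θ • w₀) :=
      (measurable_fderiv ℂ (holo g)).comp (Continuous.measurable (by fun_prop))
    exact h1.smul h2
  refine (hasFDerivAt_integral_of_dominated_of_fderiv_le (𝕜 := ℂ)
    (F' := fun w θ => ((circleMap 0 R θ ^ m)⁻¹ * circleMap 0 R θ) •
      fderiv ℂ (holo g) (circleMap 0 R θ • w))
    (bound := fun _ => (R ^ m)⁻¹ * R * (K * ‖g‖))
    (ball_mem_nhds w₀ one_pos) ?_ ?_ ?_ ?_ (integrable_const _) ?_).differentiableAt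
  · filter_upwards [ball_mem_nhds w₀ one_pos] with w hw
    exact (hcont w hw).aestronglyMeasurable
  · exact ((hcont w₀ (mem_ball_self one_pos)).integrableOn_Icc (a := 0)
      (b := 2 * Real.pi)).mono_set Ioc_subset_Icc_self
  · exact hmeasF'.aestronglyMeasurable
  · refine ae_of_all _ fun θ w hw => ?_
    rw [norm_smul, norm_mul, norm_inv, norm_pow, hnorm]
    gcongr
    exact hfd g _ (hmem θ w hw)
  · refine ae_of_all _ fun θ w hw => ?_
    have h1 := ((hf.differentiableAt (isOpen_ball.mem_nhds
      (hsub (hmem θ w hw)))).hasFDerivAt).comp w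
      ((hasFDerivAt_id w).const_smul (circleMap 0 R θ))
    have h2 := h1.const_mul ((circleMap 0 R θ ^ m)⁻¹)
    refine h2.congr_fderiv ?_
    ext v
    simp
    ring

lemma norm_inner_lt_one {n : ℕ} {z w : CSpace n} (hz : z ∈ ball (0 : CSpace n) 1)
    (hw : w ∈ ball (0 : CSpace n) 1) : ‖(inner ℂ w z : ℂ)‖ < 1 := by
  rw [mem_ball_zero_iff] at hz hw
  calc _ ≤ ‖w‖ * ‖z‖ := norm_inner_le_norm _ _
    _ < 1 := by nlinarith [norm_nonneg w, norm_nonneg z]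

lemma one_sub_inner_ne_zero {n : ℕ} {z w : CSpace n} (hz : z ∈ ball (0 : CSpace n) 1)
    (hw : w ∈ ball (0 : CSpace n) 1) : (1 - inner ℂ w z : ℂ) ≠ 0 := by
  intro h
  have h1 := norm_inner_lt_one hz hw
  rw [← sub_eq_zero.1 h, norm_one] at h1
  exact lt_irrefl _ h1

lemma integrable_holo {n : ℕ} (g : Bergman n) : Integrable (holo g) (ballVolume n) :=
  (memLp_holo g).integrable (by norm_num)

/-- Replacing `w` by `ζ w` multiplies `⟨z, w⟩ ^ m` by `ζ ^ (-m)`, so averaging over the circle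
extracts the degree `m` part of `g`, to which the homogeneous formula applies. -/
lemma integral_holo_mul_inner_pow {n : ℕ} (g : Bergman n) (m : ℕ) (z : CSpace n) :
    ((m + n).choose n : ℂ) * ∫ w, holo g w * inner ℂ w z ^ m ∂(ballVolume n) =
      homogeneousPart m (holo g) z := by
  have hin := continuous_inner_left z
  have hint : Integrable (fun w => holo g w * inner ℂ w z ^ m) (ballVolume n) := by
    refine (integrable_holo g).mul_bdd (c := ‖z‖ ^ m)
      (Continuous.aestronglyMeasurable (by fun_prop)) ?_
    filter_upwards [ae_mem_ball n] with w hw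
    rw [norm_pow]
    gcongr
    calc _ ≤ ‖w‖ * ‖z‖ := norm_inner_le_norm _ _
      _ ≤ 1 * ‖z‖ := by
        gcongr
        exact (mem_ball_zero_iff.1 hw).le
      _ = _ := one_mul _
  rw [integral_eq_integral_circleAverage (isCircular_ballVolume n) hint,
    ← integral_homogeneous_mul_inner_pow (isHomogeneousFun_homogeneousPart m (holo g))
      (differentiable_homogeneousPart m g) z]
  congr 1
  refine integral_congr_ae ?_
  filter_upwards [ae_mem_ball n] with w hw
  have hw1 : (1 : ℝ) * ‖w‖ < 1 := by simpa using hw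
  rw [homogeneousPart_eq_circleAverage m (holo_differentiableOn g) one_pos hw1]
  have h1 : EqOn (fun ζ : ℂ => holo g (ζ • w) * inner ℂ (ζ • w) z ^ m)
      (fun ζ : ℂ => (inner ℂ w z ^ m) • ((ζ ^ m)⁻¹ * holo g (ζ • w))) (sphere 0 |1|) := by
    intro ζ hζ
    rw [mem_sphere_zero_iff_norm, abs_one] at hζ
    have : (starRingEnd ℂ) ζ = ζ⁻¹ := by
      rw [Complex.inv_def, Complex.normSq_eq_norm_sq, hζ]; simp
    simp only [inner_smul_left, this, mul_pow, inv_pow, smul_eq_mul]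
    ring
  rw [Real.circleAverage_congr_sphere h1, Real.circleAverage_fun_smul, smul_eq_mul, mul_comm]

/-- The reproducing formula of the Bergman space of the ball. -/
theorem integral_holo_div_pow {n : ℕ} (g : Bergman n) {z : CSpace n}
    (hz : z ∈ ball (0 : CSpace n) 1) :
    ∫ w, holo g w / (1 - inner ℂ w z) ^ (n + 1) ∂(ballVolume n) = holo g z := by
  have hz1 : ‖z‖ < 1 := by simpa using hz
  have hin := continuous_inner_left z
  have hgm := measurable_holo g
  -- The kernel is the binomial series `∑ (m+n choose n) x ^ m = (1 - x) ^ (-(n + 1))`. Its terms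
  -- are dominated on the ball by those at `x = ‖z‖`, which allows termwise integration.
  have hs := (hasSum_choose_mul_geometric_of_norm_lt_one n (r := ‖z‖) (by simpa using hz1))
  have h1 : HasSum (fun m : ℕ => ∫ w, holo g w * (((m + n).choose n : ℂ) * inner ℂ w z ^ m)
      ∂(ballVolume n)) (∫ w, holo g w / (1 - inner ℂ w z) ^ (n + 1) ∂(ballVolume n)) := by
    refine hasSum_integral_of_dominated_convergence
      (fun m w => ‖holo g w‖ * (((m + n).choose n : ℝ) * ‖z‖ ^ m)) ?_ ?_ ?_ ?_ ?_
    · exact fun m => (hgm.mul (Continuous.measurable (by fun_prop))).aestronglyMeasurable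
    · intro m
      filter_upwards [ae_mem_ball n] with w hw
      rw [norm_mul, norm_mul, norm_pow, Complex.norm_natCast]
      gcongr
      calc _ ≤ ‖w‖ * ‖z‖ := norm_inner_le_norm _ _
        _ ≤ 1 * ‖z‖ := by
          gcongr
          exact (mem_ball_zero_iff.1 hw).le
        _ = _ := one_mul _
    · exact ae_of_all _ fun w => hs.summable.mul_left _
    · simp only [(hs.mul_left _).tsum_eq]
      exact (integrable_holo g).norm.mul_const _
    · filter_upwards [ae_mem_ball n] with w hw
      have := (hasSum_choose_mul_geometric_of_norm_lt_one n (norm_inner_lt_one hz hw)).mul_left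
        (holo g w)
      simpa [div_eq_mul_inv] using this
  refine h1.unique ?_
  refine (hasSum_homogeneousPart (holo_differentiableOn g) hz).congr_fun fun m => ?_
  rw [← integral_holo_mul_inner_pow, ← integral_const_mul]
  congr 1
  ext w
  ring

/-! ### Carleson embedding, reproducing kernel and Toeplitz operator -/

lemma eLpNorm_two_sq {α : Type*} [MeasurableSpace α] (ν : Measure α) (f : α → ℂ) :
    eLpNorm f 2 ν ^ 2 = ∫⁻ w, ‖f w‖ₑ ^ 2 ∂ν := by
  have := eLpNorm_nnreal_pow_eq_lintegral (μ := ν) (f := f) (p := 2) (by norm_num)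
  simpa using this

lemma enorm_toLp_sq {α : Type*} [MeasurableSpace α] {ν : Measure α} {f : α → ℂ}
    (hf : MemLp f 2 ν) : ‖hf.toLp f‖ₑ ^ 2 = ∫⁻ w, ‖f w‖ₑ ^ 2 ∂ν := by
  rw [Lp.enorm_toLp, eLpNorm_two_sq]

lemma Bergman.enorm_sq {n : ℕ} (f : Bergman n) :
    ‖f‖ₑ ^ 2 = ∫⁻ w, ‖holo f w‖ₑ ^ 2 ∂(ballVolume n) := by
  rw [← eLpNorm_two_sq, ← eLpNorm_congr_ae (holo_ae_eq f), ← Lp.enorm_def]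
  rfl

lemma IsCarlesonMeasure.memLp {n : ℕ} {ν : Measure (CSpace n)} (hν : IsCarlesonMeasure ν)
    (f : Bergman n) : MemLp (holo f) 2 ν := by
  refine ⟨(measurable_holo f).aestronglyMeasurable, ?_⟩
  obtain ⟨K, hK⟩ := hν
  have h := hK f
  rw [← eLpNorm_two_sq, ← Bergman.enorm_sq] at h
  have h2 : eLpNorm (holo f) 2 ν ^ 2 < ∞ :=
    h.trans_lt (ENNReal.mul_lt_top (by simp) (by simp))
  simpa using h2

/-- The embedding of the Bergman space into `L²(ν)`, for a Carleson measure `ν`. -/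
def carlesonEmbedding {n : ℕ} {ν : Measure (CSpace n)} (hν : IsCarlesonMeasure ν) :
    Bergman n →L[ℂ] Lp ℂ 2 ν :=
  LinearMap.mkContinuous
    { toFun := fun f => (hν.memLp f).toLp (holo f)
      map_add' := fun f g => by
        rw [← MemLp.toLp_add]
        exact MemLp.toLp_congr _ _ (ae_of_all _ fun w => holo_add f g w)
      map_smul' := fun c f => by
        rw [RingHom.id_apply, ← MemLp.toLp_const_smul]
        exact MemLp.toLp_congr _ _ (ae_of_all _ fun w => holo_smul c f w) }
    (Real.sqrt hν.choose) (fun f => by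
      have h := hν.choose_spec f
      rw [← enorm_toLp_sq (hν.memLp f), ← Bergman.enorm_sq] at h
      have h2 := ENNReal.toReal_mono (ENNReal.mul_ne_top (by simp) (by simp)) h
      rw [ENNReal.toReal_mul, ENNReal.toReal_pow, ENNReal.toReal_pow, toReal_enorm,
        toReal_enorm, ENNReal.coe_toReal] at h2
      refine abs_le_of_sq_le_sq' ?_ (by positivity) |>.2
      rw [mul_pow, Real.sq_sqrt (by positivity)]
      exact h2)

lemma carlesonEmbedding_ae_eq {n : ℕ} {ν : Measure (CSpace n)} (hν : IsCarlesonMeasure ν)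
    (f : Bergman n) : carlesonEmbedding hν f =ᵐ[ν] holo f := (hν.memLp f).coeFn_toLp

lemma enorm_carlesonEmbedding_sq {n : ℕ} {ν : Measure (CSpace n)} (hν : IsCarlesonMeasure ν)
    (f : Bergman n) : ‖carlesonEmbedding hν f‖ₑ ^ 2 = ∫⁻ w, ‖holo f w‖ₑ ^ 2 ∂ν :=
  enorm_toLp_sq (hν.memLp f)

lemma inner_carlesonEmbedding {n : ℕ} {ν : Measure (CSpace n)} (hν : IsCarlesonMeasure ν)
    (f g : Bergman n) : inner ℂ (carlesonEmbedding hν f) (carlesonEmbedding hν g) =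
      ∫ w, holo g w * (starRingEnd ℂ) (holo f w) ∂ν := by
  rw [L2.inner_def]
  refine integral_congr_ae ?_
  filter_upwards [carlesonEmbedding_ae_eq hν f, carlesonEmbedding_ae_eq hν g] with w h1 h2
  rw [h1, h2]
  rfl

lemma Bergman.inner_eq_integral {n : ℕ} (f g : Bergman n) :
    inner ℂ f g = ∫ w, holo g w * (starRingEnd ℂ) (holo f w) ∂(ballVolume n) := by
  change inner ℂ f.toL2 g.toL2 = _
  rw [L2.inner_def]
  refine integral_congr_ae ?_
  filter_upwards [holo_ae_eq f, holo_ae_eq g] with w h1 h2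
  rw [h1, h2]
  rfl

lemma differentiableOn_kernel {n : ℕ} {z : CSpace n} (hz : z ∈ ball (0 : CSpace n) 1) :
    DifferentiableOn ℂ (fun w : CSpace n => 1 / (1 - inner ℂ z w : ℂ) ^ (n + 1)) (ball 0 1) := by
  have hin : Differentiable ℂ (fun w : CSpace n => (inner ℂ z w : ℂ)) :=
    (innerSL ℂ z).differentiable
  have hden : DifferentiableOn ℂ (fun w : CSpace n => (1 - inner ℂ z w : ℂ) ^ (n + 1))
      (ball 0 1) := ((hin.const_sub 1).pow (n + 1)).differentiableOn
  simp only [one_div]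
  refine DifferentiableOn.fun_inv hden fun w hw => ?_
  exact pow_ne_zero _ (one_sub_inner_ne_zero hw hz)

lemma one_sub_norm_le_norm_one_sub_inner {n : ℕ} (z : CSpace n) {w : CSpace n}
    (hw : w ∈ ball (0 : CSpace n) 1) : 1 - ‖z‖ ≤ ‖(1 - inner ℂ z w : ℂ)‖ := by
  have h1 : ‖(inner ℂ z w : ℂ)‖ ≤ ‖z‖ * ‖w‖ := norm_inner_le_norm z w
  have h2 := norm_sub_norm_le (1 : ℂ) (inner ℂ z w)
  rw [mem_ball_zero_iff] at hw
  rw [norm_one] at h2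
  nlinarith [norm_nonneg z]

lemma memLp_kernel {n : ℕ} {z : CSpace n} (hz : z ∈ ball (0 : CSpace n) 1) :
    MemLp (fun w : CSpace n => 1 / (1 - inner ℂ z w : ℂ) ^ (n + 1)) 2 (ballVolume n) := by
  have hin : Continuous (fun w : CSpace n => (inner ℂ z w : ℂ)) := by fun_prop
  refine MemLp.of_bound (Measurable.aestronglyMeasurable (by fun_prop))
    (1 / (1 - ‖z‖) ^ (n + 1)) ?_
  filter_upwards [ae_mem_ball n] with w hw
  have hz1 : 0 < 1 - ‖z‖ := by have := mem_ball_zero_iff.1 hz; linarith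
  rw [norm_div, norm_pow, norm_one]
  gcongr
  exact one_sub_norm_le_norm_one_sub_inner z hw

/-- The reproducing kernel `w ↦ (1 - ⟨w, z⟩)^{-(n+1)}` of the Bergman space. -/
def bergmanKernel {n : ℕ} {z : CSpace n} (hz : z ∈ ball (0 : CSpace n) 1) : Bergman n :=
  Bergman.mk (fun w => 1 / (1 - inner ℂ z w : ℂ) ^ (n + 1)) (differentiableOn_kernel hz)
    (memLp_kernel hz)

lemma holo_bergmanKernel {n : ℕ} {z w : CSpace n} (hz : z ∈ ball (0 : CSpace n) 1)
    (hw : w ∈ ball (0 : CSpace n) 1) :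
    holo (bergmanKernel hz) w = 1 / (1 - inner ℂ z w : ℂ) ^ (n + 1) :=
  holo_mk _ _ hw

lemma conj_holo_bergmanKernel {n : ℕ} {z w : CSpace n} (hz : z ∈ ball (0 : CSpace n) 1)
    (hw : w ∈ ball (0 : CSpace n) 1) :
    (starRingEnd ℂ) (holo (bergmanKernel hz) w) = 1 / (1 - inner ℂ w z : ℂ) ^ (n + 1) := by
  rw [holo_bergmanKernel hz hw, map_div₀, map_pow, map_sub, map_one, inner_conj_symm]

/-- The reproducing property. -/
lemma inner_bergmanKernel {n : ℕ} {z : CSpace n} (hz : z ∈ ball (0 : CSpace n) 1)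
    (f : Bergman n) : inner ℂ (bergmanKernel hz) f = holo f z := by
  rw [Bergman.inner_eq_integral, ← integral_holo_div_pow f hz]
  refine integral_congr_ae ?_
  filter_upwards [ae_mem_ball n] with w hw
  rw [conj_holo_bergmanKernel hz hw, mul_one_div]

lemma norm_bergmanKernel_sq {n : ℕ} {z : CSpace n} (hz : z ∈ ball (0 : CSpace n) 1) :
    ‖bergmanKernel hz‖ ^ 2 = 1 / (1 - ‖z‖ ^ 2) ^ (n + 1) := by
  have h := inner_self_eq_norm_sq_to_K (𝕜 := ℂ) (bergmanKernel hz)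
  rw [inner_bergmanKernel, holo_bergmanKernel hz hz, inner_self_eq_norm_sq_to_K] at h
  simp only [Complex.coe_algebraMap] at h
  exact_mod_cast h.symm

/-- The operator `T_ν`, as `J* J` for the Carleson embedding `J`. -/
def toeplitz {n : ℕ} {ν : Measure (CSpace n)} (hν : IsCarlesonMeasure ν) :
    Bergman n →L[ℂ] Bergman n :=
  (ContinuousLinearMap.adjoint (carlesonEmbedding hν)).comp (carlesonEmbedding hν)

lemma isSelfAdjoint_toeplitz {n : ℕ} {ν : Measure (CSpace n)} (hν : IsCarlesonMeasure ν) :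
    IsSelfAdjoint (toeplitz hν) := by
  rw [ContinuousLinearMap.isSelfAdjoint_iff', toeplitz, ContinuousLinearMap.adjoint_comp,
    ContinuousLinearMap.adjoint_adjoint]

lemma inner_toeplitz {n : ℕ} {ν : Measure (CSpace n)} (hν : IsCarlesonMeasure ν)
    (f g : Bergman n) :
    inner ℂ f (toeplitz hν g) = inner ℂ (carlesonEmbedding hν f) (carlesonEmbedding hν g) := by
  rw [toeplitz, ContinuousLinearMap.comp_apply, ContinuousLinearMap.adjoint_inner_right]

/-- By the reproducing property `(T f)(z) = ⟨K_z, J* J f⟩ = ⟨J K_z, J f⟩`, which is the integral in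
question. It converges absolutely as the integral of a product of two functions in `L²(ν)`. -/
lemma isToeplitzOperator_toeplitz {n : ℕ} {ν : Measure (CSpace n)} (hν : IsCarlesonMeasure ν)
    (hb : ∀ᵐ w ∂ν, w ∈ ball (0 : CSpace n) 1) : IsToeplitzOperator ν (toeplitz hν) := by
  intro f z hz
  have heq : (fun w => holo f w * (starRingEnd ℂ) (holo (bergmanKernel hz) w)) =ᵐ[ν]
      fun w => holo f w / (1 - inner ℂ w z) ^ (n + 1) := by
    filter_upwards [hb] with w hw
    rw [conj_holo_bergmanKernel hz hw, mul_one_div]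
  constructor
  · refine Integrable.congr ?_ heq
    exact (hν.memLp f).integrable_mul (hν.memLp (bergmanKernel hz)).star
  · rw [← inner_bergmanKernel hz, inner_toeplitz, inner_carlesonEmbedding]
    exact integral_congr_ae heq

/-! ### Estimates of the Schur kernel against Carleson measures -/

lemma norm_one_sub_inner_comm {n : ℕ} (z w : CSpace n) :
    ‖(1 - inner ℂ z w : ℂ)‖ = ‖(1 - inner ℂ w z : ℂ)‖ := by
  rw [← RCLike.norm_conj (1 - inner ℂ z w : ℂ), map_sub, map_one, inner_conj_symm]

/-- In the unit ball `‖z‖² + ‖w‖² ≤ 2`, so `‖z - w‖² ≤ 2 Re (1 - ⟨z, w⟩)`. This is the source of the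
half order gained by the factor `z - w` over the Bergman kernel. -/
lemma norm_sub_sq_le {n : ℕ} {z w : CSpace n} (hz : z ∈ ball (0 : CSpace n) 1)
    (hw : w ∈ ball (0 : CSpace n) 1) : ‖z - w‖ ^ 2 ≤ 2 * ‖(1 - inner ℂ z w : ℂ)‖ := by
  have h1 := norm_sub_sq (𝕜 := ℂ) z w
  have h2 := Complex.re_le_norm (1 - inner ℂ z w : ℂ)
  rw [mem_ball_zero_iff] at hz hw
  simp only [Complex.sub_re, Complex.one_re, RCLike.re_eq_complex_re] at h1 h2
  nlinarith [norm_nonneg z, norm_nonneg w]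

/-- A Carleson measure of a nonisotropic ball of radius `δ` is `O(δ^{n+1})`. -/
lemma IsCarlesonMeasure.exists_measure_le {n : ℕ} {ν : Measure (CSpace n)}
    (hν : IsCarlesonMeasure ν) (hb : ∀ᵐ w ∂ν, w ∈ ball (0 : CSpace n) 1) :
    ∃ C : ℝ≥0, ∀ z ∈ ball (0 : CSpace n) 1, ∀ δ : ℝ, 0 < δ → δ ≤ 1 →
      ν {w | ‖(1 - inner ℂ z w : ℂ)‖ ≤ δ} ≤ C * ENNReal.ofReal (δ ^ (n + 1)) := by
  obtain ⟨K, hK⟩ := hν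
  refine ⟨4 ^ (n + 1) * K, fun z hz δ hδ hδ1 => ?_⟩
  have hzn : ‖z‖ < 1 := by simpa using hz
  -- The Carleson inequality is tested on the kernel at `z' = (1 - δ) z`. Its squared norm is at
  -- most `δ ^ (-(n + 1))`, while its modulus on `S` is at least `(2 δ) ^ (-(n + 1))`, because `1 -
  -- ⟨z', w⟩` differs from `1 - ⟨z, w⟩` by at most `δ`.
  set z' : CSpace n := ((1 - δ : ℝ) : ℂ) • z with hz'
  have hz'n : ‖z'‖ ≤ 1 - δ := by
    rw [hz', norm_smul, Complex.norm_real, Real.norm_eq_abs, abs_of_nonneg (by linarith)]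
    nlinarith [norm_nonneg z]
  have hz'b : z' ∈ ball (0 : CSpace n) 1 := by
    rw [mem_ball_zero_iff]; linarith
  have hnorm : ‖bergmanKernel hz'b‖ ^ 2 ≤ 1 / δ ^ (n + 1) := by
    rw [norm_bergmanKernel_sq]
    gcongr
    nlinarith [norm_nonneg z']
  set S := {w : CSpace n | ‖(1 - inner ℂ z w : ℂ)‖ ≤ δ} with hS
  have hSm : MeasurableSet S :=
    measurableSet_le (Continuous.measurable (by fun_prop)) measurable_const
  have hpt : ∀ᵐ w ∂ν, w ∈ S → (1 : ℝ≥0∞) ≤ ENNReal.ofReal ((2 * δ) ^ (2 * (n + 1))) *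
      ‖holo (bergmanKernel hz'b) w‖ₑ ^ 2 := by
    filter_upwards [hb] with w hw hwS
    have hwn : ‖w‖ < 1 := by simpa using hw
    have hd0 : 0 < ‖(1 - inner ℂ z' w : ℂ)‖ := norm_pos_iff.2 (one_sub_inner_ne_zero hw hz'b)
    have hd : ‖(1 - inner ℂ z' w : ℂ)‖ ≤ 2 * δ := by
      have : (1 - inner ℂ z' w : ℂ) = (1 - inner ℂ z w) + (δ : ℂ) * inner ℂ z w := by
        rw [hz', inner_smul_left, Complex.conj_ofReal]; push_cast; ring
      rw [this]
      refine (norm_add_le _ _).trans ?_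
      have h1 : ‖(inner ℂ z w : ℂ)‖ ≤ 1 := (norm_inner_lt_one hw hz).le
      have h2 : ‖(1 - inner ℂ z w : ℂ)‖ ≤ δ := hwS
      rw [norm_mul, Complex.norm_real, Real.norm_eq_abs, abs_of_pos hδ]
      nlinarith
    rw [holo_bergmanKernel hz'b hw, ← ofReal_norm, ← ENNReal.ofReal_pow (norm_nonneg _),
      ← ENNReal.ofReal_mul (by positivity), ← ENNReal.ofReal_one]
    refine ENNReal.ofReal_le_ofReal ?_
    rw [norm_div, norm_one, norm_pow, div_pow, one_pow, ← pow_mul, mul_one_div,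
      le_div_iff₀ (by positivity), one_mul, mul_comm (n + 1) 2]
    gcongr
  calc ν S = ∫⁻ _ in S, 1 ∂ν := by simp
    _ ≤ ∫⁻ w in S, ENNReal.ofReal ((2 * δ) ^ (2 * (n + 1))) *
        ‖holo (bergmanKernel hz'b) w‖ₑ ^ 2 ∂ν :=
      setLIntegral_mono_ae' hSm hpt
    _ ≤ ∫⁻ w, ENNReal.ofReal ((2 * δ) ^ (2 * (n + 1))) *
        ‖holo (bergmanKernel hz'b) w‖ₑ ^ 2 ∂ν := setLIntegral_le_lintegral _ _
    _ = ENNReal.ofReal ((2 * δ) ^ (2 * (n + 1))) *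
        ∫⁻ w, ‖holo (bergmanKernel hz'b) w‖ₑ ^ 2 ∂ν :=
      lintegral_const_mul _ ((measurable_holo _).enorm.pow_const 2)
    _ ≤ ENNReal.ofReal ((2 * δ) ^ (2 * (n + 1))) * (K * ‖bergmanKernel hz'b‖ₑ ^ 2) := by
      gcongr
      rw [Bergman.enorm_sq]
      exact hK _
    _ ≤ ENNReal.ofReal ((2 * δ) ^ (2 * (n + 1))) * (K * ENNReal.ofReal (1 / δ ^ (n + 1))) := by
      gcongr
      rw [← ofReal_norm, ← ENNReal.ofReal_pow (norm_nonneg _)]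
      exact ENNReal.ofReal_le_ofReal hnorm
    _ = _ := by
      rw [← ENNReal.ofReal_coe_nnreal, ← ENNReal.ofReal_coe_nnreal,
        ← ENNReal.ofReal_mul (by positivity), ← ENNReal.ofReal_mul (by positivity),
        ← ENNReal.ofReal_mul (by positivity)]
      congr 1
      push_cast
      have h4 : (2 * δ) ^ (2 * (n + 1)) = 4 ^ (n + 1) * (δ ^ (n + 1) * δ ^ (n + 1)) := by
        rw [pow_mul, show (2 * δ) ^ 2 = 4 * (δ * δ) by ring, mul_pow, mul_pow]
      rw [h4]
      field_simp

/-- The kernel `‖z - w‖ / |1 - ⟨w, z⟩|^{n+1}`. -/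
def schurKernel {n : ℕ} (z w : CSpace n) : ℝ≥0∞ :=
  ENNReal.ofReal (‖z - w‖ / ‖(1 - inner ℂ z w : ℂ)‖ ^ (n + 1))

lemma schurKernel_comm {n : ℕ} (z w : CSpace n) : schurKernel z w = schurKernel w z := by
  rw [schurKernel, schurKernel, norm_sub_rev, norm_one_sub_inner_comm]

lemma measurable_schurKernel (n : ℕ) :
    Measurable (fun p : CSpace n × CSpace n => schurKernel p.1 p.2) := by
  have h1 : Continuous (fun p : CSpace n × CSpace n => (inner ℂ p.1 p.2 : ℂ)) := by fun_prop
  unfold schurKernel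
  exact ENNReal.measurable_ofReal.comp (Measurable.div (Continuous.measurable (by fun_prop))
    (Continuous.measurable (by fun_prop)))

lemma schurKernel_le {n : ℕ} {z w : CSpace n} {r δ : ℝ} (hδ : 0 < δ) (hr : ‖z - w‖ ≤ r)
    (hd : δ ≤ ‖(1 - inner ℂ z w : ℂ)‖) : schurKernel z w ≤ ENNReal.ofReal (r / δ ^ (n + 1)) := by
  have : 0 ≤ r := (norm_nonneg _).trans hr
  refine ENNReal.ofReal_le_ofReal ?_
  gcongr

/-- The value of `schurKernel` on the `j`-th dyadic shell. -/
def shellWeight (n j : ℕ) : ℝ := 2 * (1 / 2) ^ j / ((1 / 4) ^ (j + 1)) ^ (n + 1)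

/-- Where `d = |1 - ⟨z, w⟩|` is at least `4 ^ (-k)`, the bound `‖z - w‖ ≤ 2` suffices. Otherwise `4
^ (-(j + 1)) < d ≤ 4 ^ (-j)` for some `j ≥ k`, and there `‖z - w‖ ≤ √(2 d) ≤ 2 · 2 ^ (-j)`. The
ratio `1 / 4` makes these square roots powers of `1 / 2`. -/
lemma schurKernel_le_tsum {n : ℕ} {z w : CSpace n} (hz : z ∈ ball (0 : CSpace n) 1)
    (hw : w ∈ ball (0 : CSpace n) 1) (k : ℕ) :
    schurKernel z w ≤ ENNReal.ofReal (2 / ((1 / 4) ^ k) ^ (n + 1)) +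
      ∑' i : ℕ, {w | ‖(1 - inner ℂ z w : ℂ)‖ ≤ (1 / 4) ^ (k + i)}.indicator
        (fun _ => ENNReal.ofReal (shellWeight n (k + i))) w := by
  set d := ‖(1 - inner ℂ z w : ℂ)‖ with hd
  have hd0 : 0 < d := norm_pos_iff.2 (one_sub_inner_ne_zero hw hz)
  have hzw := norm_sub_sq_le hz hw
  by_cases hdk : (1 / 4 : ℝ) ^ k ≤ d
  · refine le_add_right (schurKernel_le (by positivity) ?_ hdk)
    have := norm_sub_le z w
    rw [mem_ball_zero_iff] at hz hw
    linarith
  · refine le_add_left ?_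
    push Not at hdk
    obtain ⟨i, hi1, hi2⟩ := exists_nat_pow_near_of_lt_one (x := d / (1 / 4) ^ k) (y := 1 / 4)
      (by positivity) ((div_le_one (by positivity)).2 hdk.le) (by norm_num) (by norm_num)
    rw [div_le_iff₀ (by positivity), mul_comm, ← pow_add] at hi2
    rw [lt_div_iff₀ (by positivity), mul_comm, ← pow_add, ← add_assoc] at hi1
    refine le_trans ?_ (ENNReal.le_tsum i)
    rw [indicator_of_mem (show w ∈ {w | ‖(1 - inner ℂ z w : ℂ)‖ ≤ (1 / 4) ^ (k + i)} from hi2)]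
    refine schurKernel_le (by positivity) ?_ hi1.le
    refine abs_le_of_sq_le_sq' ?_ (by positivity) |>.2
    have : (1 / 4 : ℝ) ^ (k + i) = ((1 / 2) ^ (k + i)) ^ 2 := by
      rw [← pow_mul, mul_comm, pow_mul]; norm_num
    rw [this] at hi2
    calc _ ≤ 2 * d := hzw
      _ ≤ _ := by nlinarith

/-- Integrals of the Schur kernel against a Carleson measure. -/
lemma IsCarlesonMeasure.exists_setLIntegral_schurKernel_le {n : ℕ} {ν : Measure (CSpace n)}
    (hν : IsCarlesonMeasure ν) (hb : ∀ᵐ w ∂ν, w ∈ ball (0 : CSpace n) 1) :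
    ∃ D : ℝ≥0, ∀ z ∈ ball (0 : CSpace n) 1, ∀ (k : ℕ) (A : Set (CSpace n)),
      ∫⁻ w in A, schurKernel z w ∂ν ≤ D * ENNReal.ofReal ((1 / 2) ^ k) +
        ENNReal.ofReal (2 / ((1 / 4) ^ k) ^ (n + 1)) * ν A := by
  obtain ⟨C, hC⟩ := hν.exists_measure_le hb
  -- The set `A` matters only where `|1 - ⟨z, w⟩|` exceeds `4 ^ (-k)`; the sets from the remaining
  -- sum are integrated in full. The first factor `4` is `2` from `shellWeight` times `2` from the
  -- geometric series.
  refine ⟨C * (4 * 4 ^ (n + 1)), fun z hz k A => ?_⟩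
  have hm : ∀ i : ℕ, MeasurableSet {w : CSpace n | ‖(1 - inner ℂ z w : ℂ)‖ ≤ (1 / 4) ^ (k + i)} :=
    fun i => measurableSet_le (Continuous.measurable (by fun_prop)) measurable_const
  -- The Carleson bound `C 4 ^ (-j (n + 1))` with `j = k + i` cancels the singularity in
  -- `shellWeight` up to the constant `4 ^ (n + 1)`, and the gained factor `2 ^ (-j)` remains.
  have hterm : ∀ i : ℕ, ENNReal.ofReal (shellWeight n (k + i)) *
      ν {w : CSpace n | ‖(1 - inner ℂ z w : ℂ)‖ ≤ (1 / 4) ^ (k + i)} ≤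
      C * ENNReal.ofReal (2 * 4 ^ (n + 1) * (1 / 2) ^ k) * ENNReal.ofReal (1 / 2) ^ i := by
    intro i
    have hw0 : 0 ≤ shellWeight n (k + i) := by unfold shellWeight; positivity
    calc _ ≤ ENNReal.ofReal (shellWeight n (k + i)) *
          (C * ENNReal.ofReal (((1 / 4) ^ (k + i)) ^ (n + 1))) := by
          gcongr
          exact hC z hz _ (by positivity) (pow_le_one₀ (by norm_num) (by norm_num))
      _ = _ := by
          rw [mul_left_comm, ← ENNReal.ofReal_mul hw0, mul_assoc,
            ← ENNReal.ofReal_pow (by norm_num), ← ENNReal.ofReal_mul (by positivity)]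
          congr 2
          rw [shellWeight, pow_succ (1 / 4 : ℝ) (k + i), mul_pow, pow_add (1 / 2 : ℝ), one_div_pow 4 (n + 1)]
          field_simp
  calc ∫⁻ w in A, schurKernel z w ∂ν
      ≤ ∫⁻ w in A, (ENNReal.ofReal (2 / ((1 / 4) ^ k) ^ (n + 1)) +
        ∑' i : ℕ, {w | ‖(1 - inner ℂ z w : ℂ)‖ ≤ (1 / 4) ^ (k + i)}.indicator
        (fun _ => ENNReal.ofReal (shellWeight n (k + i))) w) ∂ν :=
        lintegral_mono_ae ((ae_restrict_of_ae hb).mono fun w hw => schurKernel_le_tsum hz hw k)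
    _ = ENNReal.ofReal (2 / ((1 / 4) ^ k) ^ (n + 1)) * ν A +
        ∑' i : ℕ, ∫⁻ w in A, {w | ‖(1 - inner ℂ z w : ℂ)‖ ≤ (1 / 4) ^ (k + i)}.indicator
        (fun _ => ENNReal.ofReal (shellWeight n (k + i))) w ∂ν := by
        rw [lintegral_add_left measurable_const, setLIntegral_const,
          lintegral_tsum fun i => (measurable_const.indicator (hm i)).aemeasurable]
    _ ≤ ENNReal.ofReal (2 / ((1 / 4) ^ k) ^ (n + 1)) * ν A +
        ∑' i : ℕ, C * ENNReal.ofReal (2 * 4 ^ (n + 1) * (1 / 2) ^ k) *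
          ENNReal.ofReal (1 / 2) ^ i := by
        gcongr with i
        refine (setLIntegral_le_lintegral _ _).trans ?_
        rw [lintegral_indicator_const (hm i)]
        exact hterm i
    _ = _ := by
        rw [ENNReal.tsum_mul_left, ENNReal.tsum_geometric, add_comm]
        congr 1
        have h2 : (1 - ENNReal.ofReal (1 / 2))⁻¹ = ENNReal.ofReal 2 := by
          rw [← ENNReal.ofReal_one, ← ENNReal.ofReal_sub _ (by norm_num),
            ← ENNReal.ofReal_inv_of_pos (by norm_num)]
          norm_num
        rw [h2, mul_assoc, ← ENNReal.ofReal_mul (by positivity), ← ENNReal.ofReal_coe_nnreal,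
          ← ENNReal.ofReal_coe_nnreal, ← ENNReal.ofReal_mul (by positivity),
          ← ENNReal.ofReal_mul (by positivity)]
        congr 1
        push_cast
        ring

/-! ### A compactness criterion and multiplication operators on `L²(ν)` -/

/-- Applied to differences, the estimate carries a finite net of the image of the unit ball under
`R`, with centres in that image, to a finite net of its image under `A`. -/
lemma isCompactOperator_of_norm_le {E F G : Type*} [NormedAddCommGroup E] [NormedSpace ℂ E]
    [NormedAddCommGroup F] [NormedSpace ℂ F] [CompleteSpace F] [NormedAddCommGroup G]
    [NormedSpace ℂ G] {A : E →L[ℂ] F} {R : E →L[ℂ] G} (hR : IsCompactOperator R) {C : ℝ}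
    (h : ∀ x, ‖A x‖ ≤ C * ‖R x‖) : IsCompactOperator A := by
  refine (isCompactOperator_iff_isCompact_closure_image_ball (A : E →ₗ[ℂ] F) one_pos).2 ?_
  refine isCompact_iff_totallyBounded_isComplete.2
    ⟨TotallyBounded.closure ?_, isClosed_closure.isComplete⟩
  have hRt : TotallyBounded (R '' ball 0 1) := by
    obtain ⟨K, hK, hsub⟩ := (isCompactOperator_iff_image_ball_subset_compact (R : E →ₗ[ℂ] G)
      one_pos).1 hR
    exact hK.totallyBounded.subset hsub
  refine Metric.totallyBounded_iff.2 fun ε hε => ?_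
  have hC : 0 < |C| + 1 := by positivity
  obtain ⟨t, ht, htf, hcov⟩ := Metric.finite_approx_of_totallyBounded hRt (ε / (|C| + 1))
    (by positivity)
  choose! p hp using fun y (hy : y ∈ t) => ht hy
  refine ⟨(fun y => A (p y)) '' t, htf.image _, ?_⟩
  rintro _ ⟨x, hx, rfl⟩
  obtain ⟨y, hy, hxy⟩ := mem_iUnion₂.1 (hcov (mem_image_of_mem R hx))
  refine mem_iUnion₂.2 ⟨A (p y), mem_image_of_mem _ hy, ?_⟩
  rw [mem_ball, dist_eq_norm, ← (hp y hy).2, ← map_sub, lt_div_iff₀ hC] at hxy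
  rw [mem_ball, dist_eq_norm]
  change ‖A x - A (p y)‖ < ε
  rw [← map_sub]
  calc _ ≤ C * ‖R (x - p y)‖ := h _
    _ ≤ ‖R (x - p y)‖ * (|C| + 1) := by
      nlinarith [norm_nonneg (R (x - p y)), le_abs_self C]
    _ < ε := hxy

lemma ae_norm_mul_le {α : Type*} [MeasurableSpace α] {ν : Measure α} {φ : α → ℂ}
    (hb : ∀ᵐ w ∂ν, ‖φ w‖ ≤ 1) (f : Lp ℂ 2 ν) : ∀ᵐ w ∂ν, ‖φ w * f w‖ ≤ ‖f w‖ := by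
  filter_upwards [hb] with w hw
  rw [norm_mul]
  exact mul_le_of_le_one_left (norm_nonneg _) hw

lemma memLp_mul {α : Type*} [MeasurableSpace α] {ν : Measure α} {φ : α → ℂ} (hφ : Measurable φ)
    (hb : ∀ᵐ w ∂ν, ‖φ w‖ ≤ 1) (f : Lp ℂ 2 ν) : MemLp (fun w => φ w * f w) 2 ν :=
  (Lp.memLp f).mono (hφ.aestronglyMeasurable.mul (Lp.aestronglyMeasurable f))
    (ae_norm_mul_le hb f)

/-- Multiplication on `L²(ν)` by a measurable function that is bounded by `1`. -/
def mulLp {α : Type*} [MeasurableSpace α] {ν : Measure α} {φ : α → ℂ} (hφ : Measurable φ)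
    (hb : ∀ᵐ w ∂ν, ‖φ w‖ ≤ 1) : Lp ℂ 2 ν →L[ℂ] Lp ℂ 2 ν :=
  LinearMap.mkContinuous
    { toFun := fun f => (memLp_mul hφ hb f).toLp _
      map_add' := fun f g => by
        rw [← MemLp.toLp_add]
        refine MemLp.toLp_congr _ _ ?_
        filter_upwards [Lp.coeFn_add f g] with w hw
        simp only [hw, Pi.add_apply]; ring
      map_smul' := fun c f => by
        rw [RingHom.id_apply, ← MemLp.toLp_const_smul]
        refine MemLp.toLp_congr _ _ ?_
        filter_upwards [Lp.coeFn_smul c f] with w hw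
        simp only [hw, Pi.smul_apply, smul_eq_mul]; ring }
    1 (fun f => by
      rw [one_mul]
      refine Lp.norm_le_norm_of_ae_le ?_
      filter_upwards [(memLp_mul hφ hb f).coeFn_toLp, ae_norm_mul_le hb f] with w h1 h2
      exact (congrArg norm h1).trans_le h2)

lemma mulLp_ae_eq {α : Type*} [MeasurableSpace α] {ν : Measure α} {φ : α → ℂ}
    (hφ : Measurable φ) (hb : ∀ᵐ w ∂ν, ‖φ w‖ ≤ 1) (f : Lp ℂ 2 ν) :
    mulLp hφ hb f =ᵐ[ν] fun w => φ w * f w :=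
  (memLp_mul hφ hb f).coeFn_toLp

lemma mulLp_comm {α : Type*} [MeasurableSpace α] {ν : Measure α} {φ ψ : α → ℂ}
    (hφ : Measurable φ) (hb : ∀ᵐ w ∂ν, ‖φ w‖ ≤ 1) (hψ : Measurable ψ)
    (hb' : ∀ᵐ w ∂ν, ‖ψ w‖ ≤ 1) (f : Lp ℂ 2 ν) :
    mulLp hφ hb (mulLp hψ hb' f) = mulLp hψ hb' (mulLp hφ hb f) := by
  refine Lp.ext ?_
  filter_upwards [mulLp_ae_eq hφ hb (mulLp hψ hb' f), mulLp_ae_eq hψ hb' (mulLp hφ hb f),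
    mulLp_ae_eq hφ hb f, mulLp_ae_eq hψ hb' f] with w h1 h2 h3 h4
  rw [h1, h2, h3, h4]; ring

lemma inner_mulLp_left {α : Type*} [MeasurableSpace α] {ν : Measure α} {φ ψ : α → ℂ}
    (hφ : Measurable φ) (hb : ∀ᵐ w ∂ν, ‖φ w‖ ≤ 1) (hψ : Measurable ψ)
    (hb' : ∀ᵐ w ∂ν, ‖ψ w‖ ≤ 1) (h : ∀ w, ψ w = (starRingEnd ℂ) (φ w)) (f g : Lp ℂ 2 ν) :
    inner ℂ (mulLp hφ hb f) g = inner ℂ f (mulLp hψ hb' g) := by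
  rw [L2.inner_def, L2.inner_def]
  refine integral_congr_ae ?_
  filter_upwards [mulLp_ae_eq hφ hb f, mulLp_ae_eq hψ hb' g] with w h1 h2
  simp only [h1, h2, h, RCLike.inner_apply, map_mul]
  ring

lemma ae_norm_coord_le_one {n : ℕ} {ν : Measure (CSpace n)}
    (hb : ∀ᵐ w ∂ν, w ∈ ball (0 : CSpace n) 1) (i : Fin n) : ∀ᵐ w ∂ν, ‖w i‖ ≤ 1 := by
  filter_upwards [hb] with w hw
  exact (PiLp.norm_apply_le w i).trans (mem_ball_zero_iff.1 hw).le

/-- Multiplication by the coordinate `w_i` on `L²(ν)`. -/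
def coordLp {n : ℕ} {ν : Measure (CSpace n)} (hb : ∀ᵐ w ∂ν, w ∈ ball (0 : CSpace n) 1)
    (i : Fin n) : Lp ℂ 2 ν →L[ℂ] Lp ℂ 2 ν :=
  mulLp (φ := fun w : CSpace n => w i) (by fun_prop) (ae_norm_coord_le_one hb i)

/-- Multiplication by the conjugate of the coordinate `w_i` on `L²(ν)`. -/
def conjCoordLp {n : ℕ} {ν : Measure (CSpace n)} (hb : ∀ᵐ w ∂ν, w ∈ ball (0 : CSpace n) 1)
    (i : Fin n) : Lp ℂ 2 ν →L[ℂ] Lp ℂ 2 ν :=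
  mulLp (φ := fun w : CSpace n => (starRingEnd ℂ) (w i))
    (Complex.continuous_conj.measurable.comp (by fun_prop))
    (by simpa using ae_norm_coord_le_one hb i)

lemma coordLp_carlesonEmbedding {n : ℕ} {ν : Measure (CSpace n)} (hν : IsCarlesonMeasure ν)
    (hb : ∀ᵐ w ∂ν, w ∈ ball (0 : CSpace n) 1) (i : Fin n) (f : Bergman n) :
    coordLp hb i (carlesonEmbedding hν f) = carlesonEmbedding hν (coordMul i f) := by
  refine Lp.ext ?_
  filter_upwards [mulLp_ae_eq (φ := fun w : CSpace n => w i) (by fun_prop)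
    (ae_norm_coord_le_one hb i) (carlesonEmbedding hν f), carlesonEmbedding_ae_eq hν f,
    carlesonEmbedding_ae_eq hν (coordMul i f)] with w h1 h2 h3
  rw [coordLp, h1, h2, h3, holo_coordMul]

/-! ### The defect operator and the Schur test -/

/-- The operator `f ↦ conj w_i f - M_{z_i}^* f` from the Bergman space to `L²(ν)`. -/
def defectOp {n : ℕ} {ν : Measure (CSpace n)} (hν : IsCarlesonMeasure ν)
    (hb : ∀ᵐ w ∂ν, w ∈ ball (0 : CSpace n) 1) (i : Fin n) : Bergman n →L[ℂ] Lp ℂ 2 ν :=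
  (conjCoordLp hb i).comp (carlesonEmbedding hν) -
    (carlesonEmbedding hν).comp (ContinuousLinearMap.adjoint (coordMul i))

/-- Both terms are pairings with the kernel at `w`: the second is `⟨K_w, M* f⟩ = ⟨M K_w, f⟩`. Thus
`f` is paired with `z ↦ (w_i - z_i) K_w(z)`, whose extra factor vanishes at `z = w`. -/
lemma conj_coord_mul_holo_sub {n : ℕ} {w : CSpace n} (hw : w ∈ ball (0 : CSpace n) 1)
    (i : Fin n) (f : Bergman n) :
    (starRingEnd ℂ) (w i) * holo f w - holo (ContinuousLinearMap.adjoint (coordMul i) f) w =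
      inner ℂ (w i • bergmanKernel hw - coordMul i (bergmanKernel hw)) f := by
  rw [inner_sub_left, inner_smul_left, inner_bergmanKernel, ← inner_bergmanKernel hw
    (ContinuousLinearMap.adjoint (coordMul i) f), ContinuousLinearMap.adjoint_inner_right]

lemma enorm_conj_coord_mul_holo_sub_le {n : ℕ} {w : CSpace n} (hw : w ∈ ball (0 : CSpace n) 1)
    (i : Fin n) (f : Bergman n) :
    ‖(starRingEnd ℂ) (w i) * holo f w -
      holo (ContinuousLinearMap.adjoint (coordMul i) f) w‖ₑ ≤
      ∫⁻ z, schurKernel w z * ‖holo f z‖ₑ ∂(ballVolume n) := by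
  rw [conj_coord_mul_holo_sub hw, Bergman.inner_eq_integral]
  refine (enorm_integral_le_lintegral_enorm _).trans (lintegral_mono_ae ?_)
  filter_upwards [ae_mem_ball n] with z hz
  rw [enorm_mul, mul_comm]
  gcongr
  rw [← ofReal_norm, schurKernel]
  refine ENNReal.ofReal_le_ofReal ?_
  rw [RCLike.norm_conj, holo_sub, holo_smul, holo_coordMul, holo_bergmanKernel hw hz,
    ← sub_mul, norm_mul, norm_div, norm_one, norm_pow, mul_one_div]
  gcongr
  exact PiLp.norm_apply_le (w - z) i

lemma enorm_defectOp_le {n : ℕ} {ν : Measure (CSpace n)} (hν : IsCarlesonMeasure ν)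
    (hb : ∀ᵐ w ∂ν, w ∈ ball (0 : CSpace n) 1) (i : Fin n) (f : Bergman n) :
    ∀ᵐ w ∂ν, ‖defectOp hν hb i f w‖ₑ ≤
      ∫⁻ z, schurKernel w z * ‖holo f z‖ₑ ∂(ballVolume n) := by
  have h1 : defectOp hν hb i f = conjCoordLp hb i (carlesonEmbedding hν f) -
    carlesonEmbedding hν (ContinuousLinearMap.adjoint (coordMul i) f) := rfl
  rw [h1]
  filter_upwards [hb, mulLp_ae_eq (φ := fun w : CSpace n => (starRingEnd ℂ) (w i))
    (Complex.continuous_conj.measurable.comp (by fun_prop))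
    (by simpa using ae_norm_coord_le_one hb i) (carlesonEmbedding hν f),
    carlesonEmbedding_ae_eq hν f,
    carlesonEmbedding_ae_eq hν (ContinuousLinearMap.adjoint (coordMul i) f),
    Lp.coeFn_sub (conjCoordLp hb i (carlesonEmbedding hν f))
      (carlesonEmbedding hν (ContinuousLinearMap.adjoint (coordMul i) f))] with w hw h2 h3 h4 h5
  rw [h5, Pi.sub_apply, conjCoordLp, h2, h3, h4]
  exact enorm_conj_coord_mul_holo_sub_le hw i f

/-- Cauchy-Schwarz inequality with a weight. -/
lemma lintegral_mul_sq_le {α : Type*} [MeasurableSpace α] {ν : Measure α} {k a : α → ℝ≥0∞}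
    (hk : Measurable k) (ha : Measurable a) :
    (∫⁻ z, k z * a z ∂ν) ^ 2 ≤ (∫⁻ z, k z ∂ν) * ∫⁻ z, k z * a z ^ 2 ∂ν := by
  have h := ENNReal.lintegral_mul_norm_pow_le (μ := ν) (f := k) (g := fun z => k z * a z ^ 2)
    hk.aemeasurable (hk.mul (ha.pow_const 2)).aemeasurable (p := 1 / 2) (q := 1 / 2)
    (by norm_num) (by norm_num) (by norm_num)
  have h1 : ∀ z, k z ^ (1 / 2 : ℝ) * (k z * a z ^ 2) ^ (1 / 2 : ℝ) = k z * a z := by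
    intro z
    rw [ENNReal.mul_rpow_of_nonneg _ _ (by norm_num), ← mul_assoc,
      ← ENNReal.rpow_add_of_nonneg _ _ (by norm_num) (by norm_num), ← ENNReal.rpow_natCast_mul]
    norm_num
  simp only [h1] at h
  calc _ ≤ ((∫⁻ z, k z ∂ν) ^ (1 / 2 : ℝ) * (∫⁻ z, k z * a z ^ 2 ∂ν) ^ (1 / 2 : ℝ)) ^ 2 := by
        gcongr
    _ = _ := by
        rw [mul_pow, ← ENNReal.rpow_mul_natCast, ← ENNReal.rpow_mul_natCast]
        norm_num

lemma isCarlesonMeasure_ballVolume (n : ℕ) : IsCarlesonMeasure (ballVolume n) :=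
  ⟨1, fun f => by simp⟩

/-- Schur test for the operator `defectOp`, with a gain close to the boundary. -/
lemma exists_lintegral_defectOp_le {n : ℕ} {ν : Measure (CSpace n)} [IsFiniteMeasure ν]
    (hν : IsCarlesonMeasure ν) (hb : ∀ᵐ w ∂ν, w ∈ ball (0 : CSpace n) 1) (i : Fin n) :
    ∃ D : ℝ≥0, ∀ (k : ℕ) (A : Set (CSpace n)) (f : Bergman n),
      ∫⁻ w in A, ‖defectOp hν hb i f w‖ₑ ^ 2 ∂ν ≤ (D * ENNReal.ofReal ((1 / 2) ^ k) +
        D * ENNReal.ofReal (2 / ((1 / 4) ^ k) ^ (n + 1)) * ν A) * ‖f‖ₑ ^ 2 := by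
  obtain ⟨D₁, hD₁⟩ := (isCarlesonMeasure_ballVolume n).exists_setLIntegral_schurKernel_le
    (ae_mem_ball n)
  obtain ⟨D₂, hD₂⟩ := hν.exists_setLIntegral_schurKernel_le hb
  -- The case `k = 0`, `A = univ` of the kernel estimate for the volume, whose total mass is `1`.
  have hvol : ∀ w ∈ ball (0 : CSpace n) 1,
      ∫⁻ z, schurKernel w z ∂(ballVolume n) ≤ ((D₁ + 2 : ℝ≥0) : ℝ≥0∞) := by
    intro w hw
    simpa using hD₁ w hw 0 univ
  refine ⟨(D₁ + 2) * (D₂ + 1), fun k A f => ?_⟩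
  have hm := measurable_schurKernel n
  have hfm := (measurable_holo f).enorm
  -- `S` bounds the integral over `w ∈ A` of the kernel against `ν`, uniformly in `z`. The gain near
  -- the boundary comes from this factor of the Schur test, while the integral over `z` is merely
  -- bounded.
  set S := D₂ * ENNReal.ofReal ((1 / 2) ^ k) +
    ENNReal.ofReal (2 / ((1 / 4) ^ k) ^ (n + 1)) * ν A with hS
  calc ∫⁻ w in A, ‖defectOp hν hb i f w‖ₑ ^ 2 ∂ν
      ≤ ∫⁻ w in A, ((D₁ + 2 : ℝ≥0) : ℝ≥0∞) *
          ∫⁻ z, schurKernel w z * ‖holo f z‖ₑ ^ 2 ∂(ballVolume n) ∂ν := by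
        refine lintegral_mono_ae (ae_restrict_of_ae ?_)
        filter_upwards [hb, enorm_defectOp_le hν hb i f] with w hw h1
        calc _ ≤ (∫⁻ z, schurKernel w z * ‖holo f z‖ₑ ∂(ballVolume n)) ^ 2 := by gcongr
          _ ≤ _ := lintegral_mul_sq_le hm.of_uncurry_left hfm
          _ ≤ _ := by gcongr; exact hvol w hw
    _ = ((D₁ + 2 : ℝ≥0) : ℝ≥0∞) * ∫⁻ w in A, ∫⁻ z, schurKernel w z * ‖holo f z‖ₑ ^ 2
          ∂(ballVolume n) ∂ν :=
        lintegral_const_mul' _ _ ENNReal.coe_ne_top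
    _ = ((D₁ + 2 : ℝ≥0) : ℝ≥0∞) * ∫⁻ z, ∫⁻ w in A, schurKernel w z * ‖holo f z‖ₑ ^ 2 ∂ν
          ∂(ballVolume n) := by
        rw [lintegral_lintegral_swap]
        exact (hm.mul ((hfm.comp measurable_snd).pow_const 2)).aemeasurable
    _ ≤ ((D₁ + 2 : ℝ≥0) : ℝ≥0∞) * ∫⁻ z, S * ‖holo f z‖ₑ ^ 2 ∂(ballVolume n) := by
        refine mul_le_mul_right (lintegral_mono_ae ?_) _
        filter_upwards [ae_mem_ball n] with z hz
        rw [lintegral_mul_const' _ _ (by simp)]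
        gcongr
        simp only [schurKernel_comm _ z]
        exact hD₂ z hz k A
    _ = ((D₁ + 2 : ℝ≥0) : ℝ≥0∞) * S * ‖f‖ₑ ^ 2 := by
        rw [lintegral_const_mul _ (hfm.pow_const 2), ← Bergman.enorm_sq, mul_assoc]
    _ ≤ _ := by
        gcongr
        rw [hS, mul_add, ← mul_assoc, ← mul_assoc]
        push_cast
        gcongr
        · exact le_self_add
        · exact le_mul_of_one_le_right (by positivity) le_add_self

/-! ### Compactness of the defect operator -/

section CompactOperators

variable {E F G : Type*} [NormedAddCommGroup E] [NormedSpace ℂ E] [NormedAddCommGroup F]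
  [NormedSpace ℂ F] [NormedAddCommGroup G] [NormedSpace ℂ G]

lemma isCompactOperator_comp_left {A : E →L[ℂ] F} (hA : IsCompactOperator A) (B : F →L[ℂ] G) :
    IsCompactOperator (B.comp A) := hA.clm_comp B

lemma isCompactOperator_comp_right {A : F →L[ℂ] G} (hA : IsCompactOperator A) (B : E →L[ℂ] F) :
    IsCompactOperator (A.comp B) := hA.comp_clm B

lemma isCompactOperator_sub {A B : E →L[ℂ] F} (hA : IsCompactOperator A)
    (hB : IsCompactOperator B) : IsCompactOperator (A - B) := hA.sub hB

end CompactOperators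

/-- Restriction of Bergman functions to a compact ball is a compact operator (Montel). -/
lemma exists_isCompactOperator_restrict {n : ℕ} {ρ : ℝ} (hρ : ρ < 1) :
    ∃ R : Bergman n →L[ℂ] (closedBall (0 : CSpace n) ρ →ᵇ ℂ),
      (∀ f x, R f x = holo f x) ∧ IsCompactOperator R := by
  have : CompactSpace (closedBall (0 : CSpace n) ρ) :=
    isCompact_iff_compactSpace.1 (isCompact_closedBall _ _)
  -- The room between `ρ` and `R₁`, and between `R₁` and `1`, gives uniform bounds for values and
  -- derivatives on the unit ball of the Bergman space: boundedness and a common Lipschitz constant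
  -- for Arzelà–Ascoli.
  set R₁ := (1 + ρ) / 2
  have h1 : ρ < R₁ := by simp only [R₁]; linarith
  have h2 : R₁ < 1 := by simp only [R₁]; linarith
  have hsub : closedBall (0 : CSpace n) ρ ⊆ ball 0 R₁ := closedBall_subset_ball h1
  have hsub1 : ball (0 : CSpace n) R₁ ⊆ ball 0 1 := ball_subset_ball h2.le
  obtain ⟨K, hK, hKf⟩ := norm_holo_le (n := n) (r := 1 - R₁) (by linarith)
  have hbound : ∀ (f : Bergman n) (x : closedBall (0 : CSpace n) ρ), ‖holo f x‖ ≤ K * ‖f‖ :=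
    fun f x => hKf f x (by
      intro w hw
      have e1 := mem_closedBall.1 hw
      have e2 := mem_ball.1 (hsub x.2)
      have e3 := dist_triangle w (x : CSpace n) 0
      exact mem_ball.2 (by linarith))
  have hcont : ∀ f : Bergman n, Continuous fun x : closedBall (0 : CSpace n) ρ => holo f x :=
    fun f => (holo_differentiableOn f).continuousOn.comp_continuous continuous_subtype_val
      fun x => hsub1 (hsub x.2)
  let R : Bergman n →L[ℂ] (closedBall (0 : CSpace n) ρ →ᵇ ℂ) :=
    LinearMap.mkContinuous
      { toFun := fun f => BoundedContinuousFunction.mkOfCompact ⟨_, hcont f⟩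
        map_add' := fun f g => by ext x; exact holo_add f g x
        map_smul' := fun c f => by ext x; exact holo_smul c f x }
      K (fun f => (BoundedContinuousFunction.norm_le (by positivity)).2 (hbound f))
  have hR : ∀ f x, R f x = holo f x := fun f x => rfl
  refine ⟨R, hR, ?_⟩
  obtain ⟨L, hL, hLf⟩ := norm_fderiv_holo_le (n := n) h2
  refine (isCompactOperator_iff_isCompact_closure_image_ball 
    (R : Bergman n →ₗ[ℂ] (closedBall (0 : CSpace n) ρ →ᵇ ℂ)) one_pos).2 ?_
  refine BoundedContinuousFunction.arzela_ascoli (closedBall (0 : ℂ) K)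
    (isCompact_closedBall _ _) _ ?_ ?_
  · rintro _ x ⟨f, hf, rfl⟩
    rw [mem_closedBall_zero_iff]
    rw [mem_ball_zero_iff] at hf
    calc _ ≤ K * ‖f‖ := hbound f x
      _ ≤ K := by nlinarith
  · refine (LipschitzWith.uniformEquicontinuous _ ⟨L, hL⟩ ?_).equicontinuous
    rintro ⟨_, f, hf, rfl⟩
    refine LipschitzWith.of_dist_le_mul fun x y => ?_
    rw [mem_ball_zero_iff] at hf
    have h3 := (convex_ball (0 : CSpace n) R₁).norm_image_sub_le_of_norm_fderiv_le (𝕜 := ℂ)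
      (f := holo f) (C := L * ‖f‖) (fun z hz => (holo_differentiableOn f).differentiableAt
        (isOpen_ball.mem_nhds (hsub1 hz))) (fun z hz => hLf f z hz) (hsub y.2) (hsub x.2)
    rw [dist_eq_norm, Subtype.dist_eq, dist_eq_norm]
    change ‖holo f x - holo f y‖ ≤ L * ‖(x : CSpace n) - y‖
    refine h3.trans ?_
    gcongr
    nlinarith

/-- Multiplication by the indicator function of a measurable set on `L²(ν)`. -/
def indicatorLp {α : Type*} [MeasurableSpace α] (ν : Measure α) {A : Set α}
    (hA : MeasurableSet A) : Lp ℂ 2 ν →L[ℂ] Lp ℂ 2 ν :=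
  mulLp (φ := A.indicator fun _ => 1) (measurable_const.indicator hA)
    (ae_of_all _ fun w => (norm_indicator_le_norm_self _ w).trans (by simp))

lemma indicatorLp_ae_eq {α : Type*} [MeasurableSpace α] {ν : Measure α} {A : Set α}
    (hA : MeasurableSet A) (f : Lp ℂ 2 ν) : indicatorLp ν hA f =ᵐ[ν] A.indicator f := by
  filter_upwards [mulLp_ae_eq (φ := A.indicator fun _ => 1) (measurable_const.indicator hA)
    (ae_of_all ν fun w => (norm_indicator_le_norm_self _ w).trans (by simp)) f] with w hw
  rw [indicatorLp, hw]
  by_cases h : w ∈ A <;> simp [h]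

/-- The Carleson embedding cut off to a compact ball is compact. -/
lemma isCompactOperator_indicatorLp_comp_carlesonEmbedding {n : ℕ} {ν : Measure (CSpace n)}
    [IsFiniteMeasure ν] (hν : IsCarlesonMeasure ν) {ρ : ℝ} (hρ : ρ < 1) :
    IsCompactOperator ((indicatorLp ν (measurableSet_closedBall (x := (0 : CSpace n))
      (ε := ρ))).comp (carlesonEmbedding hν)) := by
  obtain ⟨R, hR, hRc⟩ := exists_isCompactOperator_restrict (n := n) hρ
  -- As `ν` is finite, the `L²(ν)` norm of the cut-off function is at most `ν(univ) ^ (1/2)` times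
  -- its supremum on the closed ball.
  refine isCompactOperator_of_norm_le hRc
    (C := (measureUnivNNReal ν : ℝ) ^ ((2 : ℝ≥0∞).toReal)⁻¹) fun f => ?_
  refine Lp.norm_le_of_ae_bound (norm_nonneg _) ?_
  filter_upwards [indicatorLp_ae_eq (measurableSet_closedBall (x := (0 : CSpace n)) (ε := ρ))
    (carlesonEmbedding hν f), carlesonEmbedding_ae_eq hν f] with w h1 h2
  rw [ContinuousLinearMap.comp_apply, h1]
  by_cases hw : w ∈ closedBall (0 : CSpace n) ρ
  · rw [indicator_of_mem hw, h2, ← hR f ⟨w, hw⟩]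
    exact (R f).norm_coe_le_norm _
  · rw [indicator_of_notMem hw, norm_zero]
    exact norm_nonneg _

lemma indicatorLp_conjCoordLp {n : ℕ} {ν : Measure (CSpace n)}
    (hb : ∀ᵐ w ∂ν, w ∈ ball (0 : CSpace n) 1) (i : Fin n) {A : Set (CSpace n)}
    (hA : MeasurableSet A) (f : Lp ℂ 2 ν) :
    indicatorLp ν hA (conjCoordLp hb i f) = conjCoordLp hb i (indicatorLp ν hA f) :=
  mulLp_comm _ _ _ _ f

/-- Cutting off commutes with multiplication by `conj w_i`, so the cut-off defect involves only the
cut-off embedding, which is compact. -/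
lemma indicatorLp_comp_defectOp {n : ℕ} {ν : Measure (CSpace n)} (hν : IsCarlesonMeasure ν)
    (hb : ∀ᵐ w ∂ν, w ∈ ball (0 : CSpace n) 1) (i : Fin n) {A : Set (CSpace n)}
    (hA : MeasurableSet A) :
    (indicatorLp ν hA).comp (defectOp hν hb i) =
      (conjCoordLp hb i).comp ((indicatorLp ν hA).comp (carlesonEmbedding hν)) -
      ((indicatorLp ν hA).comp (carlesonEmbedding hν)).comp
        (ContinuousLinearMap.adjoint (coordMul i)) := by
  ext1 f
  change indicatorLp ν hA (conjCoordLp hb i (carlesonEmbedding hν f) -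
    carlesonEmbedding hν (ContinuousLinearMap.adjoint (coordMul i) f)) =
    conjCoordLp hb i (indicatorLp ν hA (carlesonEmbedding hν f)) -
    indicatorLp ν hA (carlesonEmbedding hν (ContinuousLinearMap.adjoint (coordMul i) f))
  rw [map_sub, indicatorLp_conjCoordLp]

lemma isCompactOperator_indicatorLp_comp_defectOp {n : ℕ} {ν : Measure (CSpace n)}
    [IsFiniteMeasure ν] (hν : IsCarlesonMeasure ν) (hb : ∀ᵐ w ∂ν, w ∈ ball (0 : CSpace n) 1)
    (i : Fin n) {ρ : ℝ} (hρ : ρ < 1) :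
    IsCompactOperator ((indicatorLp ν (measurableSet_closedBall (x := (0 : CSpace n))
      (ε := ρ))).comp (defectOp hν hb i)) := by
  have hJ := isCompactOperator_indicatorLp_comp_carlesonEmbedding hν hρ
  rw [indicatorLp_comp_defectOp]
  exact isCompactOperator_sub (isCompactOperator_comp_left hJ _)
    (isCompactOperator_comp_right hJ _)

lemma tendsto_measure_compl_closedBall {n : ℕ} {ν : Measure (CSpace n)} [IsFiniteMeasure ν]
    (hb : ∀ᵐ w ∂ν, w ∈ ball (0 : CSpace n) 1) :
    Tendsto (fun m : ℕ => ν (closedBall (0 : CSpace n) (1 - 1 / ((m : ℝ) + 1)))ᶜ) atTop (𝓝 0) := by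
  have hanti : Antitone fun m : ℕ => (closedBall (0 : CSpace n) (1 - 1 / ((m : ℝ) + 1)))ᶜ := by
    intro a b hab
    refine compl_subset_compl.2 (closedBall_subset_closedBall ?_)
    have : (1 : ℝ) / ((b : ℝ) + 1) ≤ 1 / ((a : ℝ) + 1) := by gcongr
    linarith
  have h := tendsto_measure_iInter_atTop (μ := ν)
    (fun m : ℕ => (measurableSet_closedBall (x := (0 : CSpace n))
      (ε := 1 - 1 / ((m : ℝ) + 1))).compl.nullMeasurableSet) hanti ⟨0, measure_ne_top _ _⟩
  have h0 : ν (⋂ m : ℕ, (closedBall (0 : CSpace n) (1 - 1 / ((m : ℝ) + 1)))ᶜ) = 0 := by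
    refine measure_mono_null ?_ (ae_iff.1 hb)
    intro w hw hwb
    have hw1 : 0 < 1 - ‖w‖ := by
      have := mem_ball_zero_iff.1 hwb
      linarith
    obtain ⟨m, hm⟩ := exists_nat_one_div_lt hw1
    refine mem_iInter.1 hw m ?_
    rw [mem_closedBall_zero_iff]
    linarith
  rwa [h0] at h

/-- For every Carleson measure, `f ↦ conj w_i f - M_{z_i}^* f` is compact. -/
theorem isCompactOperator_defectOp {n : ℕ} {ν : Measure (CSpace n)} [IsFiniteMeasure ν]
    (hν : IsCarlesonMeasure ν) (hb : ∀ᵐ w ∂ν, w ∈ ball (0 : CSpace n) 1) (i : Fin n) :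
    IsCompactOperator (defectOp hν hb i) := by
  obtain ⟨D, hD⟩ := exists_lintegral_defectOp_le hν hb i
  have hcl := isClosed_setOfPred_isCompactOperator (𝕜₁ := ℂ) (𝕜₂ := ℂ) (σ₁₂ := RingHom.id ℂ)
    (M₁ := Bergman n) (M₂ := Lp ℂ 2 ν)
  -- Compact operators are norm closed, so it suffices to approximate the defect by its cut-offs to
  -- closed balls of radius `ρ < 1`.
  refine hcl.closure_subset_iff.2 Subset.rfl (Metric.mem_closure_iff.2 fun ε hε => ?_)
  have hε2 : (0 : ℝ≥0∞) < ENNReal.ofReal (ε / 2) ^ 2 / 2 := by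
    refine ENNReal.div_pos (pow_ne_zero 2 (ENNReal.ofReal_pos.2 (by positivity)).ne') (by simp)
  have ht1 : Tendsto (fun k : ℕ => (D : ℝ≥0∞) * ENNReal.ofReal ((1 / 2) ^ k)) atTop (𝓝 0) := by
    have h1 : Tendsto (fun k : ℕ => ENNReal.ofReal ((1 / 2 : ℝ) ^ k)) atTop (𝓝 0) := by
      have := ENNReal.tendsto_ofReal
        (tendsto_pow_atTop_nhds_zero_of_lt_one (r := (1 / 2 : ℝ)) (by norm_num) (by norm_num))
      rwa [ENNReal.ofReal_zero] at this
    simpa using ENNReal.Tendsto.const_mul h1 (Or.inr ENNReal.coe_ne_top)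
  -- The order of choices matters: `k` makes the near-diagonal part small, and only then is the ball
  -- taken so large that the mass outside it beats the constant `2 · 4 ^ (k (n + 1))`.
  obtain ⟨k, hk⟩ := (ht1.eventually (gt_mem_nhds hε2)).exists
  have ht2 : Tendsto (fun m : ℕ => (D : ℝ≥0∞) * ENNReal.ofReal (2 / ((1 / 4) ^ k) ^ (n + 1)) *
      ν (closedBall (0 : CSpace n) (1 - 1 / ((m : ℝ) + 1)))ᶜ) atTop (𝓝 0) := by
    have := ENNReal.Tendsto.const_mul (a := (D : ℝ≥0∞) * ENNReal.ofReal (2 / ((1 / 4) ^ k) ^ (n + 1)))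
      (tendsto_measure_compl_closedBall hb)
      (Or.inr (ENNReal.mul_ne_top ENNReal.coe_ne_top ENNReal.ofReal_ne_top))
    rwa [mul_zero] at this
  obtain ⟨m, hm⟩ := (ht2.eventually (gt_mem_nhds hε2)).exists
  have hρ : 1 - 1 / ((m : ℝ) + 1) < 1 := by
    have : (0 : ℝ) < 1 / ((m : ℝ) + 1) := by positivity
    linarith
  refine ⟨_, isCompactOperator_indicatorLp_comp_defectOp hν hb i hρ, ?_⟩
  set B := closedBall (0 : CSpace n) (1 - 1 / ((m : ℝ) + 1)) with hB
  have hBm : MeasurableSet B := measurableSet_closedBall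
  rw [dist_eq_norm]
  refine (ContinuousLinearMap.opNorm_le_bound _ (by positivity : 0 ≤ ε / 2) fun f => ?_).trans_lt
    (by linarith)
  set X := defectOp hν hb i f with hX
  have h1 : ‖X - indicatorLp ν hBm X‖ₑ ^ 2 = ∫⁻ w in Bᶜ, ‖X w‖ₑ ^ 2 ∂ν := by
    rw [Lp.enorm_def, eLpNorm_two_sq, ← lintegral_indicator hBm.compl]
    refine lintegral_congr_ae ?_
    filter_upwards [Lp.coeFn_sub X (indicatorLp ν hBm X), indicatorLp_ae_eq hBm X] with w h2 h3
    rw [h2, Pi.sub_apply, h3]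
    by_cases hw : w ∈ B
    · simp [hw]
    · simp [hw]
  have h2 : ‖X - indicatorLp ν hBm X‖ₑ ^ 2 ≤ (ENNReal.ofReal (ε / 2) * ‖f‖ₑ) ^ 2 := by
    rw [h1, mul_pow]
    refine (hD k Bᶜ f).trans ?_
    gcongr
    calc _ ≤ ENNReal.ofReal (ε / 2) ^ 2 / 2 + ENNReal.ofReal (ε / 2) ^ 2 / 2 :=
          add_le_add hk.le hm.le
      _ = _ := ENNReal.add_halves _
  have h3 : ‖X - indicatorLp ν hBm X‖ₑ ≤ ENNReal.ofReal (ε / 2) * ‖f‖ₑ :=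
    (ENNReal.pow_le_pow_left_iff two_ne_zero).1 h2
  have h4 := ENNReal.toReal_mono (ENNReal.mul_ne_top ENNReal.ofReal_ne_top (by simp)) h3
  rw [ENNReal.toReal_mul, toReal_enorm, toReal_enorm, ENNReal.toReal_ofReal (by positivity)] at h4
  exact h4

/-! ### Spectral gap and the projection as a function of `T` -/

section SpectralGap

variable {H : Type*} [NormedAddCommGroup H] [InnerProductSpace ℂ H] {T : H →L[ℂ] H}
  {P : Submodule ℂ H} [P.HasOrthogonalProjection] {c : ℝ}

lemma apply_eq_apply_sub_starProjection (hP : ∀ f ∈ P, T f = 0) (f : H) :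
    T (f - P.starProjection f) = T f := by
  rw [map_sub, hP _ (P.starProjection_apply_mem f), sub_zero]

variable [CompleteSpace H]

lemma inner_apply_eq_inner_apply_sub_starProjection (hT : IsSelfAdjoint T)
    (hP : ∀ f ∈ P, T f = 0) (f : H) :
    inner ℂ f (T f) = inner ℂ (f - P.starProjection f) (T (f - P.starProjection f)) := by
  have h0 : inner ℂ (P.starProjection f) (T f) = 0 := by
    rw [← hT.adjoint_eq, ContinuousLinearMap.adjoint_inner_right,
      hP _ (P.starProjection_apply_mem f), inner_zero_left]
  rw [apply_eq_apply_sub_starProjection hP, inner_sub_left, h0, sub_zero]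

lemma re_inner_apply_nonneg (hT : IsSelfAdjoint T) (hc : 0 < c) (hP : ∀ f ∈ P, T f = 0)
    (hQ : ∀ f ∈ Pᗮ, c * ‖f‖ ^ 2 ≤ (inner ℂ f (T f)).re) (f : H) : 0 ≤ (inner ℂ f (T f)).re := by
  rw [inner_apply_eq_inner_apply_sub_starProjection hT hP]
  exact (by positivity : (0 : ℝ) ≤ _).trans (hQ _ (P.sub_starProjection_mem_orthogonal f))

/-- The operator inequality `c T ≤ T²`. On the component `q` in `Pᗮ`, Cauchy–Schwarz upgrades the
lower bound of the form to `c ‖q‖ ≤ ‖T q‖`, whence `c ⟨q, T q⟩ ≤ c ‖q‖ ‖T q‖ ≤ ‖T q‖²`. -/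
lemma mul_re_inner_apply_le (hT : IsSelfAdjoint T) (hc : 0 < c) (hP : ∀ f ∈ P, T f = 0)
    (hQ : ∀ f ∈ Pᗮ, c * ‖f‖ ^ 2 ≤ (inner ℂ f (T f)).re) (f : H) :
    c * (inner ℂ f (T f)).re ≤ ‖T f‖ ^ 2 := by
  rw [inner_apply_eq_inner_apply_sub_starProjection hT hP,
    ← apply_eq_apply_sub_starProjection hP f]
  set q := f - P.starProjection f
  have h1 := hQ q (P.sub_starProjection_mem_orthogonal f)
  have h2 : (inner ℂ q (T q)).re ≤ ‖q‖ * ‖T q‖ :=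
    (Complex.re_le_norm _).trans (norm_inner_le_norm _ _)
  rcases eq_or_lt_of_le (norm_nonneg q) with hq | hq
  · rw [← hq, zero_mul] at h2
    nlinarith [norm_nonneg (T q)]
  · have h3 : c * ‖q‖ ≤ ‖T q‖ := by
      have : ‖q‖ * (c * ‖q‖) ≤ ‖q‖ * ‖T q‖ := by nlinarith
      exact le_of_mul_le_mul_left this hq
    nlinarith [norm_nonneg (T q)]

/-- Both `T` and `T² - c T` are positive, so every spectral value satisfies `x ≥ 0` and `x² ≥ c x`.
-/
lemma zero_or_le_of_mem_spectrum (hT : IsSelfAdjoint T) (hc : 0 < c) (hP : ∀ f ∈ P, T f = 0)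
    (hQ : ∀ f ∈ Pᗮ, c * ‖f‖ ^ 2 ≤ (inner ℂ f (T f)).re) {x : ℝ} (hx : x ∈ spectrum ℝ T) :
    x = 0 ∨ c ≤ x := by
  have hsymm : ∀ f : H, inner ℂ (T f) f = inner ℂ f (T f) := fun f => by
    rw [← ContinuousLinearMap.adjoint_inner_right, hT.adjoint_eq]
  have hpos : 0 ≤ T := by
    rw [ContinuousLinearMap.nonneg_iff_isPositive, ContinuousLinearMap.isPositive_def']
    refine ⟨hT, fun f => ?_⟩
    rw [ContinuousLinearMap.reApplyInnerSelf_apply, hsymm]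
    exact re_inner_apply_nonneg hT hc hP hQ f
  have hx0 : 0 ≤ x := spectrum_nonneg_of_nonneg hpos hx
  have hcfc : cfc (fun x : ℝ => x * x - c * x) T = T * T - c • T := by
    rw [cfc_sub _ _ T, cfc_mul _ _ T, cfc_const_mul _ _ T, cfc_id' ℝ T]
  have hpos2 : 0 ≤ cfc (fun x : ℝ => x * x - c * x) T := by
    rw [ContinuousLinearMap.nonneg_iff_isPositive, ContinuousLinearMap.isPositive_def']
    refine ⟨cfc_predicate _ T, fun f => ?_⟩
    rw [hcfc, ContinuousLinearMap.reApplyInnerSelf_apply]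
    have h1 : inner ℂ ((T * T - c • T) f) f = inner ℂ (T f) (T f) - c * inner ℂ f (T f) := by
      change inner ℂ (T (T f) - c • T f) f = _
      rw [inner_sub_left, ← Complex.coe_smul, inner_smul_left, Complex.conj_ofReal, hsymm f,
        ← ContinuousLinearMap.adjoint_inner_right T, hT.adjoint_eq]
    rw [h1, RCLike.re_eq_complex_re, Complex.sub_re, Complex.re_ofReal_mul,
      inner_self_eq_norm_sq_to_K]
    have := mul_re_inner_apply_le hT hc hP hQ f
    simp only [Complex.coe_algebraMap]
    norm_cast
    linarith
  have h2 := (cfc_nonneg_iff (fun x : ℝ => x * x - c * x) T).1 hpos2 x hx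
  rcases eq_or_lt_of_le hx0 with h | h
  · exact Or.inl h.symm
  · right
    nlinarith

/-- If `T` vanishes on `P` and is bounded below on `Pᗮ`, then the projection onto `P` is a
continuous function of `T`, and the projection onto `Pᗮ` factors through `T`. -/
lemma exists_cfc_eq_starProjection (hT : IsSelfAdjoint T) (hc : 0 < c) (hP : ∀ f ∈ P, T f = 0)
    (hQ : ∀ f ∈ Pᗮ, c * ‖f‖ ^ 2 ≤ (inner ℂ f (T f)).re) :
    ∃ (g : ℝ → ℝ) (S : H →L[ℂ] H), Continuous g ∧ P.starProjection = cfc g T ∧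
      P.starProjection = 1 - S * T := by
  -- A continuous substitute for `1 / x` that agrees with it on `[c, ∞)`. Hence `1 - x h(x)` is `1`
  -- at `0` and `0` on `[c, ∞)`.
  set h : ℝ → ℝ := fun x => (max x c)⁻¹ with hh
  have hhc : Continuous h :=
    (continuous_id.max continuous_const).inv₀ fun x => (lt_max_of_lt_right hc).ne'
  set g : ℝ → ℝ := fun x => 1 - h x * x with hg
  have hgc : Continuous g := continuous_const.sub (hhc.mul continuous_id)
  have hST : cfc g T = 1 - cfc h T * T := by
    have h1 : cfc g T = cfc (fun _ : ℝ => (1 : ℝ)) T - cfc (fun x => h x * x) T :=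
      cfc_sub _ _ T continuousOn_const (hhc.mul continuous_id).continuousOn
    have h2 : cfc (fun x => h x * x) T = cfc h T * cfc (fun x : ℝ => x) T :=
      cfc_mul _ _ T hhc.continuousOn continuousOn_id
    rw [h1, h2, cfc_const_one ℝ T hT, cfc_id' ℝ T hT]
  -- By the gap, `x g(x)` vanishes on the whole spectrum, so `g(T)` maps into the kernel of `T`,
  -- which is `P`.
  have hTG : T * cfc g T = 0 := by
    have h1 : T * cfc g T = cfc (fun x : ℝ => x * g x) T := by
      rw [cfc_mul (fun x : ℝ => x) g T continuousOn_id hgc.continuousOn, cfc_id' ℝ T hT]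
    rw [h1, ← cfc_zero ℝ T]
    refine cfc_congr fun x hx => ?_
    rcases zero_or_le_of_mem_spectrum hT hc hP hQ hx with h0 | h0
    · simp [h0]
    · have : x ≠ 0 := (hc.trans_le h0).ne'
      simp [hg, hh, max_eq_left h0, this]
  have hsa : IsSelfAdjoint (cfc g T) := cfc_predicate g T
  have hker : ∀ f, T f = 0 → f ∈ P := by
    intro f hf
    have h1 := hQ _ (P.sub_starProjection_mem_orthogonal f)
    rw [← inner_apply_eq_inner_apply_sub_starProjection hT hP, hf, inner_zero_right,
      Complex.zero_re] at h1
    have h2 : ‖f - P.starProjection f‖ = 0 := by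
      have : ‖f - P.starProjection f‖ ^ 2 ≤ 0 := by nlinarith
      exact pow_eq_zero_iff two_ne_zero |>.1 (le_antisymm this (by positivity))
    rw [norm_eq_zero, sub_eq_zero] at h2
    rw [h2]
    exact P.starProjection_apply_mem f
  have hGP : ∀ f ∈ P, cfc g T f = f := by
    intro f hf
    rw [hST]
    change f - cfc h T (T f) = f
    rw [hP f hf, map_zero, sub_zero]
  -- The vector `g(T) f` lies in `P = ker T`, and also in `Pᗮ`, because `g(T)` is self-adjoint and
  -- fixes `P`.
  have hGQ : ∀ f ∈ Pᗮ, cfc g T f = 0 := by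
    intro f hf
    have h1 : cfc g T f ∈ P := hker _ (congrArg (fun A : H →L[ℂ] H => A f) hTG)
    have h2 : cfc g T f ∈ Pᗮ := by
      intro u hu
      rw [← hsa.adjoint_eq, ContinuousLinearMap.adjoint_inner_right, hGP u hu]
      exact hf u hu
    exact inner_self_eq_zero.1 (h2 _ h1)
  have hfin : P.starProjection = cfc g T := by
    ext f
    have h1 := hGQ _ (P.sub_starProjection_mem_orthogonal f)
    rw [map_sub, sub_eq_zero] at h1
    rw [h1, hGP _ (P.starProjection_apply_mem f)]
  exact ⟨g, cfc h T, hgc, hfin, hfin.trans hST⟩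

end SpectralGap

/-! ### Essential normality from a compact off-diagonal corner -/

section EssentialNormality

variable {n : ℕ} (M : Set (CSpace n))

lemma adjoint_submoduleMul_apply (j : Fin n) (f : vanishingSubmodule M) :
    ContinuousLinearMap.adjoint (submoduleMul M j) f =
      (vanishingSubmodule M).orthogonalProjectionOnto
        (ContinuousLinearMap.adjoint (coordMul j) (f : Bergman n)) := by
  refine ext_inner_left ℂ fun u => ?_
  rw [ContinuousLinearMap.adjoint_inner_right, ← (vanishingSubmodule M).adjoint_subtypeL,
    ContinuousLinearMap.adjoint_inner_right, ContinuousLinearMap.adjoint_inner_right]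
  rfl

lemma adjoint_quotientMul_apply (j : Fin n) (f : (vanishingSubmodule M)ᗮ) :
    ContinuousLinearMap.adjoint (quotientMul M j) f =
      (vanishingSubmodule M)ᗮ.orthogonalProjectionOnto
        (ContinuousLinearMap.adjoint (coordMul j) (f : Bergman n)) := by
  refine ext_inner_left ℂ fun u => ?_
  rw [ContinuousLinearMap.adjoint_inner_right, ← (vanishingSubmodule M)ᗮ.adjoint_subtypeL,
    ContinuousLinearMap.adjoint_inner_right, ContinuousLinearMap.adjoint_inner_right, quotientMul,
    ← (vanishingSubmodule M)ᗮ.adjoint_subtypeL, ContinuousLinearMap.comp_apply,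
    ContinuousLinearMap.adjoint_inner_left]
  rfl

variable {M}

lemma starProjection_orthogonal_add (f : Bergman n) :
    f = (vanishingSubmodule M).starProjection f + (vanishingSubmodule M)ᗮ.starProjection f :=
  ((vanishingSubmodule M).starProjection_add_starProjection_orthogonal f).symm

/-- On `P` one has `A_i A_j^* = M_i P M_j^* = M_i M_j^* - M_i Q M_j^*` and `A_j^* A_i = P M_j^*
M_i`. So the commutator is the compression of `[M_i, M_j^*] - M_i (Q M_j^* P)` to `P`. -/
lemma isEssentiallyNormal_submoduleMul
    (hK : ∀ i j : Fin n, IsCompactOperator (coordMul i * ContinuousLinearMap.adjoint (coordMul j) -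
      ContinuousLinearMap.adjoint (coordMul j) * coordMul i))
    (hq : ∀ j : Fin n, IsCompactOperator (((vanishingSubmodule M)ᗮ.starProjection.comp
      (ContinuousLinearMap.adjoint (coordMul j))).comp (vanishingSubmodule M).starProjection)) :
    IsEssentiallyNormal (submoduleMul M) := by
  intro i j
  have heq : submoduleMul M i * ContinuousLinearMap.adjoint (submoduleMul M j) -
      ContinuousLinearMap.adjoint (submoduleMul M j) * submoduleMul M i =
      (vanishingSubmodule M).orthogonalProjectionOnto.comp
        (((coordMul i * ContinuousLinearMap.adjoint (coordMul j) -
          ContinuousLinearMap.adjoint (coordMul j) * coordMul i) -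
          (coordMul i).comp (((vanishingSubmodule M)ᗮ.starProjection.comp
            (ContinuousLinearMap.adjoint (coordMul j))).comp
              (vanishingSubmodule M).starProjection)).comp (vanishingSubmodule M).subtypeL) := by
    ext1 f
    change submoduleMul M i (ContinuousLinearMap.adjoint (submoduleMul M j) f) -
      ContinuousLinearMap.adjoint (submoduleMul M j) (submoduleMul M i f) =
      (vanishingSubmodule M).orthogonalProjectionOnto
        ((coordMul i (ContinuousLinearMap.adjoint (coordMul j) (f : Bergman n)) -
        ContinuousLinearMap.adjoint (coordMul j) (coordMul i (f : Bergman n))) -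
        coordMul i ((vanishingSubmodule M)ᗮ.starProjection
          (ContinuousLinearMap.adjoint (coordMul j)
            ((vanishingSubmodule M).starProjection (f : Bergman n)))))
    rw [adjoint_submoduleMul_apply, adjoint_submoduleMul_apply,
      Submodule.starProjection_eq_self_iff.2 f.2, sub_right_comm, ← map_sub (coordMul i), map_sub]
    congr 1
    have h1 : ContinuousLinearMap.adjoint (coordMul j) (f : Bergman n) -
        (vanishingSubmodule M)ᗮ.starProjection
          (ContinuousLinearMap.adjoint (coordMul j) (f : Bergman n)) =
        (vanishingSubmodule M).starProjection
          (ContinuousLinearMap.adjoint (coordMul j) (f : Bergman n)) :=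
      sub_eq_iff_eq_add.2 (starProjection_orthogonal_add _)
    rw [h1]
    exact ((vanishingSubmodule M).orthogonalProjectionOnto_mem_subspace_eq_self
      (submoduleMul M i ((vanishingSubmodule M).orthogonalProjectionOnto
        (ContinuousLinearMap.adjoint (coordMul j) (f : Bergman n))))).symm
  rw [heq]
  exact isCompactOperator_comp_left (isCompactOperator_comp_right (isCompactOperator_sub (hK i j)
    (isCompactOperator_comp_left (hq j) _)) _) _

/-- Invariance of `P` gives `Q M_i P = 0`, hence `B_i B_j^* = Q M_i M_j^*` on `Q`, whereas `B_j^*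
B_i = Q M_j^* M_i - Q M_j^* P M_i`. So the commutator is `Q [M_i, M_j^*] + (Q M_j^* P) M_i` on `Q`.
-/
lemma isEssentiallyNormal_quotientMul
    (hK : ∀ i j : Fin n, IsCompactOperator (coordMul i * ContinuousLinearMap.adjoint (coordMul j) -
      ContinuousLinearMap.adjoint (coordMul j) * coordMul i))
    (hq : ∀ j : Fin n, IsCompactOperator (((vanishingSubmodule M)ᗮ.starProjection.comp
      (ContinuousLinearMap.adjoint (coordMul j))).comp (vanishingSubmodule M).starProjection)) :
    IsEssentiallyNormal (quotientMul M) := by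
  intro i j
  have heq : quotientMul M i * ContinuousLinearMap.adjoint (quotientMul M j) -
      ContinuousLinearMap.adjoint (quotientMul M j) * quotientMul M i =
      (vanishingSubmodule M)ᗮ.orthogonalProjectionOnto.comp
        ((coordMul i * ContinuousLinearMap.adjoint (coordMul j) -
          ContinuousLinearMap.adjoint (coordMul j) * coordMul i).comp
            (vanishingSubmodule M)ᗮ.subtypeL) -
      (vanishingSubmodule M)ᗮ.orthogonalProjectionOnto.comp
          ((((vanishingSubmodule M)ᗮ.starProjection.comp
            (ContinuousLinearMap.adjoint (coordMul j))).comp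
              (vanishingSubmodule M).starProjection).comp ((-coordMul i).comp
            (vanishingSubmodule M)ᗮ.subtypeL)) := by
    ext1 f
    change (vanishingSubmodule M)ᗮ.orthogonalProjectionOnto (coordMul i
        (ContinuousLinearMap.adjoint (quotientMul M j) f : (vanishingSubmodule M)ᗮ)) -
      ContinuousLinearMap.adjoint (quotientMul M j) (quotientMul M i f) =
      (vanishingSubmodule M)ᗮ.orthogonalProjectionOnto
        (coordMul i (ContinuousLinearMap.adjoint (coordMul j) (f : Bergman n)) -
        ContinuousLinearMap.adjoint (coordMul j) (coordMul i (f : Bergman n))) -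
      (vanishingSubmodule M)ᗮ.orthogonalProjectionOnto
        ((vanishingSubmodule M)ᗮ.starProjection
          (ContinuousLinearMap.adjoint (coordMul j)
            ((vanishingSubmodule M).starProjection (-coordMul i (f : Bergman n)))))
    rw [adjoint_quotientMul_apply, adjoint_quotientMul_apply]
    change (vanishingSubmodule M)ᗮ.orthogonalProjectionOnto (coordMul i
        ((vanishingSubmodule M)ᗮ.starProjection (ContinuousLinearMap.adjoint (coordMul j)
          (f : Bergman n)))) -
      (vanishingSubmodule M)ᗮ.orthogonalProjectionOnto (ContinuousLinearMap.adjoint (coordMul j)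
        ((vanishingSubmodule M)ᗮ.starProjection (coordMul i (f : Bergman n)))) = _
    set u := ContinuousLinearMap.adjoint (coordMul j) (f : Bergman n)
    set v := coordMul i (f : Bergman n)
    set A := ContinuousLinearMap.adjoint (coordMul (n := n) j)
    have hproj : ∀ w : Bergman n, (vanishingSubmodule M)ᗮ.orthogonalProjectionOnto
        ((vanishingSubmodule M)ᗮ.starProjection w) =
        (vanishingSubmodule M)ᗮ.orthogonalProjectionOnto w := fun w =>
      (vanishingSubmodule M)ᗮ.orthogonalProjectionOnto_mem_subspace_eq_self _
    have h1 : (vanishingSubmodule M)ᗮ.orthogonalProjectionOnto (coordMul i u) =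
        (vanishingSubmodule M)ᗮ.orthogonalProjectionOnto
          (coordMul i ((vanishingSubmodule M)ᗮ.starProjection u)) := by
      conv_lhs => rw [starProjection_orthogonal_add (M := M) u]
      rw [map_add, map_add, add_eq_right, Submodule.orthogonalProjectionOnto_eq_zero_iff]
      exact Submodule.le_orthogonal_orthogonal _
        (coordMul_mem M i _ ((vanishingSubmodule M).starProjection_apply_mem u))
    have h2 : A v = A ((vanishingSubmodule M).starProjection v) +
        A ((vanishingSubmodule M)ᗮ.starProjection v) := by
      rw [← map_add, ← starProjection_orthogonal_add]
    rw [hproj, map_sub, h1, h2, map_add, map_neg, map_neg, map_neg]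
    abel
  rw [heq]
  exact isCompactOperator_sub
    (isCompactOperator_comp_left (isCompactOperator_comp_right (hK i j) _) _)
    (isCompactOperator_comp_left (isCompactOperator_comp_right (hq j) _) _)

end EssentialNormality

/-! ### Commutators expressed through the defect operator -/

lemma inner_conjCoordLp {n : ℕ} {ν : Measure (CSpace n)}
    (hb : ∀ᵐ w ∂ν, w ∈ ball (0 : CSpace n) 1) (i : Fin n) (f g : Lp ℂ 2 ν) :
    inner ℂ f (conjCoordLp hb i g) = inner ℂ (coordLp hb i f) g :=
  (inner_mulLp_left _ _ _ _ (fun _ => rfl) f g).symm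

lemma coordLp_conjCoordLp {n : ℕ} {ν : Measure (CSpace n)}
    (hb : ∀ᵐ w ∂ν, w ∈ ball (0 : CSpace n) 1) (i j : Fin n) (f : Lp ℂ 2 ν) :
    coordLp hb i (conjCoordLp hb j f) = conjCoordLp hb j (coordLp hb i f) :=
  mulLp_comm _ _ _ _ f

/-- Compression of the multiplication by `conj w_i`. -/
lemma adjoint_carlesonEmbedding_conjCoordLp {n : ℕ} {ν : Measure (CSpace n)}
    (hν : IsCarlesonMeasure ν) (hb : ∀ᵐ w ∂ν, w ∈ ball (0 : CSpace n) 1) (i : Fin n)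
    (f : Bergman n) :
    ContinuousLinearMap.adjoint (carlesonEmbedding hν)
      (conjCoordLp hb i (carlesonEmbedding hν f)) =
      ContinuousLinearMap.adjoint (coordMul i) (toeplitz hν f) := by
  refine ext_inner_left ℂ fun u => ?_
  rw [ContinuousLinearMap.adjoint_inner_right, ContinuousLinearMap.adjoint_inner_right,
    inner_toeplitz, inner_conjCoordLp, coordLp_carlesonEmbedding]

/-- The commutator of `T_ν` with `M_{z_i}^*`. -/
lemma adjoint_coordMul_mul_toeplitz_sub {n : ℕ} {ν : Measure (CSpace n)}
    (hν : IsCarlesonMeasure ν) (hb : ∀ᵐ w ∂ν, w ∈ ball (0 : CSpace n) 1) (i : Fin n)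
    (f : Bergman n) :
    ContinuousLinearMap.adjoint (coordMul i) (toeplitz hν f) -
      toeplitz hν (ContinuousLinearMap.adjoint (coordMul i) f) =
      ContinuousLinearMap.adjoint (carlesonEmbedding hν) (defectOp hν hb i f) := by
  have h : defectOp hν hb i f = conjCoordLp hb i (carlesonEmbedding hν f) -
    carlesonEmbedding hν (ContinuousLinearMap.adjoint (coordMul i) f) := rfl
  rw [h, map_sub, adjoint_carlesonEmbedding_conjCoordLp]
  rfl

/-- For the volume the embedding is isometric, and its adjoint is the Bergman projection. -/
lemma toeplitz_ballVolume {n : ℕ} (f : Bergman n) :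
    toeplitz (isCarlesonMeasure_ballVolume n) f = f := by
  refine ext_inner_left ℂ fun u => ?_
  rw [inner_toeplitz, inner_carlesonEmbedding, Bergman.inner_eq_integral]

/-- The Bergman module is essentially normal. -/
theorem isCompactOperator_commutator_coordMul {n : ℕ} (i j : Fin n) :
    IsCompactOperator (coordMul i * ContinuousLinearMap.adjoint (coordMul j) -
      ContinuousLinearMap.adjoint (coordMul j) * coordMul (n := n) i) := by
  have hν := isCarlesonMeasure_ballVolume n
  have hb := ae_mem_ball n
  have hD := isCompactOperator_defectOp hν hb j
  set J := carlesonEmbedding hν with hJ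
  -- Expanding `J* w_i D_j`: the first term is `J* conj w_j J M_i = M_j^* M_i`, and the second is
  -- `J* J M_i M_j^* = M_i M_j^*`.
  have heq : coordMul i * ContinuousLinearMap.adjoint (coordMul j) -
      ContinuousLinearMap.adjoint (coordMul j) * coordMul (n := n) i =
      ((-ContinuousLinearMap.adjoint J).comp (coordLp hb i)).comp (defectOp hν hb j) := by
    ext1 f
    change coordMul i (ContinuousLinearMap.adjoint (coordMul j) f) -
      ContinuousLinearMap.adjoint (coordMul j) (coordMul i f) =
      -ContinuousLinearMap.adjoint J (coordLp hb i (conjCoordLp hb j (J f) -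
        J (ContinuousLinearMap.adjoint (coordMul j) f)))
    rw [map_sub, coordLp_conjCoordLp, hJ, coordLp_carlesonEmbedding, coordLp_carlesonEmbedding,
      map_sub, adjoint_carlesonEmbedding_conjCoordLp, toeplitz_ballVolume, neg_sub]
    congr 1
    exact (toeplitz_ballVolume _).symm
  rw [heq]
  exact isCompactOperator_comp_left hD _

/-- If the projection onto `P` is `1 - S T_ν` and `T_ν` vanishes on `P`, then the off-diagonal
corner of `M_{z_i}^*` is compact. -/
lemma isCompactOperator_corner {n : ℕ} {ν : Measure (CSpace n)} [IsFiniteMeasure ν]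
    (hν : IsCarlesonMeasure ν) (hb : ∀ᵐ w ∂ν, w ∈ ball (0 : CSpace n) 1)
    {M : Set (CSpace n)} (hP : ∀ f ∈ vanishingSubmodule M, toeplitz hν f = 0)
    {S : Bergman n →L[ℂ] Bergman n}
    (hS : (vanishingSubmodule M).starProjection = 1 - S * toeplitz hν) (i : Fin n) :
    IsCompactOperator (((vanishingSubmodule M)ᗮ.starProjection.comp
      (ContinuousLinearMap.adjoint (coordMul i))).comp (vanishingSubmodule M).starProjection) := by
  have hQ : ∀ f, (vanishingSubmodule M)ᗮ.starProjection f = S (toeplitz hν f) := by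
    intro f
    have h1 := starProjection_orthogonal_add (M := M) f
    have h2 : (vanishingSubmodule M).starProjection f = f - S (toeplitz hν f) := by rw [hS]; rfl
    rw [h2, sub_add, eq_comm, sub_eq_self, sub_eq_zero] at h1
    exact h1.symm
  -- For `f ∈ P`, `T f = 0` turns the commutator identity into `T M_i^* f = -J* D_i f`; applying `S`
  -- on the left gives the corner.
  have heq : (((vanishingSubmodule M)ᗮ.starProjection.comp
      (ContinuousLinearMap.adjoint (coordMul i))).comp (vanishingSubmodule M).starProjection) =
      ((-S).comp (ContinuousLinearMap.adjoint (carlesonEmbedding hν))).comp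
        ((defectOp hν hb i).comp (vanishingSubmodule M).starProjection) := by
    ext1 f
    change (vanishingSubmodule M)ᗮ.starProjection (ContinuousLinearMap.adjoint (coordMul i)
      ((vanishingSubmodule M).starProjection f)) =
      -S (ContinuousLinearMap.adjoint (carlesonEmbedding hν)
        (defectOp hν hb i ((vanishingSubmodule M).starProjection f)))
    rw [hQ, ← adjoint_coordMul_mul_toeplitz_sub,
      hP _ ((vanishingSubmodule M).starProjection_apply_mem f), map_zero, zero_sub, map_neg,
      neg_neg]
  rw [heq]
  exact isCompactOperator_comp_left
    (isCompactOperator_comp_right (isCompactOperator_defectOp hν hb i) _) _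

/-! ### The measure on `M` and the conclusion -/

lemma lintegral_holo_map_subtype {n : ℕ} {M : Set (CSpace n)} (μ : Measure M) (f : Bergman n) :
    ∫⁻ w, ‖holo f w‖ₑ ^ 2 ∂(μ.map ((↑) : M → CSpace n)) = ∫⁻ w : M, ‖holo f w‖ₑ ^ 2 ∂μ :=
  lintegral_map ((measurable_holo f).enorm.pow_const 2) measurable_subtype_coe

/-- The upper estimate on `P^⊥` implies the Carleson condition. -/
lemma isCarlesonMeasure_map_subtype {n : ℕ} {M : Set (CSpace n)} {μ : Measure M} {C : ℝ}
    (h : ∀ f ∈ (vanishingSubmodule M)ᗮ,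
      ∫⁻ w : M, ‖holo f w‖ₑ ^ 2 ∂μ ≤ ENNReal.ofReal (C * ‖f‖ ^ 2)) :
    IsCarlesonMeasure (μ.map ((↑) : M → CSpace n)) := by
  refine ⟨C.toNNReal, fun f => ?_⟩
  rw [lintegral_holo_map_subtype, ← Bergman.enorm_sq]
  set p := (vanishingSubmodule M).starProjection f
  have hp : p ∈ vanishingSubmodule M := (vanishingSubmodule M).starProjection_apply_mem f
  have hq : ‖f - p‖ ≤ ‖f‖ := by
    have h1 := (vanishingSubmodule M)ᗮ.norm_starProjection_apply_le f
    rw [Submodule.starProjection_orthogonal] at h1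
    exact h1
  -- The component `p` vanishes on `M`, so the integral depends only on `f - p`, which lies in `Pᗮ`.
  calc ∫⁻ w : M, ‖holo f w‖ₑ ^ 2 ∂μ = ∫⁻ w : M, ‖holo (f - p) w‖ₑ ^ 2 ∂μ := by
        refine lintegral_congr fun w => ?_
        rw [holo_sub, hp w w.2, sub_zero]
    _ ≤ ENNReal.ofReal (C * ‖f - p‖ ^ 2) :=
        h _ ((vanishingSubmodule M).sub_starProjection_mem_orthogonal f)
    _ = ENNReal.ofReal C * ENNReal.ofReal (‖f - p‖ ^ 2) := ENNReal.ofReal_mul' (by positivity)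
    _ ≤ ENNReal.ofReal C * ENNReal.ofReal (‖f‖ ^ 2) := by gcongr
    _ = _ := by rw [ENNReal.ofReal_pow (norm_nonneg _), ofReal_norm]; rfl

lemma toeplitz_eq_zero_of_mem {n : ℕ} {M : Set (CSpace n)} {μ : Measure M}
    (hν : IsCarlesonMeasure (μ.map ((↑) : M → CSpace n))) {f : Bergman n}
    (hf : f ∈ vanishingSubmodule M) : toeplitz hν f = 0 := by
  have h : carlesonEmbedding hν f = 0 := by
    have h1 := enorm_carlesonEmbedding_sq hν f
    rw [lintegral_holo_map_subtype] at h1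
    have h2 : ∀ w : M, ‖holo f w‖ₑ ^ 2 = 0 := fun w => by rw [hf w w.2]; simp
    simpa [h2] using h1
  rw [toeplitz, ContinuousLinearMap.comp_apply, h, map_zero]

lemma le_re_inner_toeplitz {n : ℕ} {M : Set (CSpace n)} {μ : Measure M}
    (hν : IsCarlesonMeasure (μ.map ((↑) : M → CSpace n))) {c : ℝ} {f : Bergman n}
    (h : ENNReal.ofReal (c * ‖f‖ ^ 2) ≤ ∫⁻ w : M, ‖holo f w‖ₑ ^ 2 ∂μ) :
    c * ‖f‖ ^ 2 ≤ (inner ℂ f (toeplitz hν f)).re := by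
  rw [← lintegral_holo_map_subtype, ← enorm_carlesonEmbedding_sq hν, ← ofReal_norm,
    ← ENNReal.ofReal_pow (norm_nonneg _), ENNReal.ofReal_le_ofReal_iff (by positivity)] at h
  rw [inner_toeplitz, inner_self_eq_norm_sq_to_K]
  simp only [Complex.coe_algebraMap]
  norm_cast

end

theorem theorem3p1 (n : ℕ) (M : Set (EuclideanSpace ℂ (Fin n)))
    (hM : M ⊆ ball (0 : EuclideanSpace ℂ (Fin n)) 1)
    (μ : Measure M) [IsFiniteMeasure μ]
    (hμ : ∃ c > (0 : ℝ), ∃ C > (0 : ℝ), ∀ f ∈ (vanishingSubmodule M)ᗮ,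
      ENNReal.ofReal (c * ‖f‖ ^ 2) ≤ ∫⁻ w : M, ‖holo f w‖ₑ ^ 2 ∂μ ∧
      ∫⁻ w : M, ‖holo f w‖ₑ ^ 2 ∂μ ≤ ENNReal.ofReal (C * ‖f‖ ^ 2)) :
    IsCarlesonMeasure (μ.map ((↑) : M → EuclideanSpace ℂ (Fin n))) ∧
    (∃ T : Bergman n →L[ℂ] Bergman n,
      IsToeplitzOperator (μ.map ((↑) : M → EuclideanSpace ℂ (Fin n))) T ∧ IsSelfAdjoint T ∧
      ∃ g : ℝ → ℝ, Continuous g ∧ (vanishingSubmodule M).starProjection = cfc g T) ∧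
    IsEssentiallyNormal (submoduleMul M) ∧
    IsEssentiallyNormal (quotientMul M) := by
  obtain ⟨c, hc, C, hC, h⟩ := hμ
  -- `M` may fail to be measurable. The push-forward to `ℂⁿ` is concentrated on the open ball, and
  -- this is all that the estimates use.
  have hν : IsCarlesonMeasure (μ.map ((↑) : M → CSpace n)) :=
    isCarlesonMeasure_map_subtype fun f hf => (h f hf).2
  have hb : ∀ᵐ w ∂(μ.map ((↑) : M → CSpace n)), w ∈ ball (0 : CSpace n) 1 :=
    (ae_map_iff measurable_subtype_coe.aemeasurable measurableSet_ball).2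
      (ae_of_all _ fun w => hM w.2)
  have hP : ∀ f ∈ vanishingSubmodule M, toeplitz hν f = 0 := fun f hf =>
    toeplitz_eq_zero_of_mem hν hf
  obtain ⟨g, S, hg, hcfc, hS⟩ := exists_cfc_eq_starProjection (isSelfAdjoint_toeplitz hν) hc hP
    fun f hf => le_re_inner_toeplitz hν (h f hf).1
  have hq := fun i => isCompactOperator_corner hν hb hP hS i
  exact ⟨hν, ⟨toeplitz hν, isToeplitzOperator_toeplitz hν hb, isSelfAdjoint_toeplitz hν, g, hg,
    hcfc⟩, isEssentiallyNormal_submoduleMul isCompactOperator_commutator_coordMul hq,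
    isEssentiallyNormal_quotientMul isCompactOperator_commutator_coordMul hq⟩
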